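/- **Setting.** A timed-arc Petri net (TAPN) $N$ has finite disjoint sets $P$ of places and $T$ of transitions, input arcs $IA\subseteq P\times T$ and output arcs $OA\subseteq T\times P$, a guard $c(p,t)$ for each input arc (an interval $[a,a]$, $[a,b]$, $[a,b)$, $(a,b]$, $(a,b)$, $[a,\infty)$ or $(a,\infty)$ with natural $a<b$), an age invariant $\iota(p)\ni 0$ of the same form for each place, and a type for each arc: normal, inhibitor (only input arcs with guard $[0,\infty)$) or $\mathrm{transport}_\ell$, where for each $t$ a transport input arc with label $\ell$ and a transport output arc with label $\ell$ determine each other uniquely. Let ${}^\bullet t$ be the set of non-inhibitor input places and $t^\bullet$ the set of output places of $t$; the augmented multisets $\mathrm{pre}(t)$, $\mathrm{post}(t)$ are obtained by padding them with a pseudo-place $\bot$ to the common size $\max(|{}^\bullet t|,|t^\bullet|)$. We set $c(\bot,t)=\iota(\bot)=[0,\infty)$. A pairing matches, for each $t$, the elements of $\mathrm{pre}(t)$ with those of $\mathrm{post}(t)$, matching the two ends of each transport route. A marking $(\pi,v)$ of $k$ tokens consists of $\pi:\{1,\dots,k\}\to P\cup\{\bot\}$ and $v:\{1,\dots,k\}\to\mathbb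 R_{\ge0}$. A transition $t$ is enabled by a set $IN$ of tokens if $\{\pi(i)\mid i\in IN\}=\mathrm{pre}(t)$ as multisets, $v(i)\in c(\pi(i),t)$ for $i\in IN$, tokens of $IN$ on transport arcs satisfy the invariants of their target places, and no token outside $IN$ lies in a place with an inhibitor arc to $t$. Firing moves the tokens of $IN$ along the pairing, giving $\pi'=\mathrm{move}(\pi,IN,t)$, and resets the ages of those tokens of the set $R\subseteq IN$ that are not on transport arcs. A delay $d\ge0$ adds $d$ to all ages and is possible if the resulting ages satisfy all invariants. Let $\to^*$ be reachability by firings and delays. The initial marking is $(\pi_0,v_0)$ with $v_0=0$. The net is $k$-bounded: with any number of additional tokens supplied in $\bot$, no marking reachable from the initial one has more than $k$ tokens outside $\bot$. Predicates are $\psi::=p\bowtie n\mid\psi\wedge\psi\mid\psi\vee\psi$ with $p\in P$, $n\in\mathbb N_0$, ${\bowtie}\in\{<,\le,=,\ne,\ge,>\}$, where $p\bowtie n$ compares the number of tokens in $p$ with $n$; $M\models\mathrm{EF}\,\psi$ means that $M\to^*M'$ for some $M'\models\psi$. A place $p$ is monotonicity-breaking in $\psi$ if $\psi$ contains an atom $p<n$,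 $p\le n$, $p=n$ or $p\neq n$. Let $mc(\bot)=0$; let $mc(p)$ be the largest finite constant in the guards and invariants of the net if $p$ has an outgoing transport arc, and otherwise the largest finite constant in $\iota(p)$ and in the guards of the outgoing arcs of $p$. A place is untimed if its invariant and all its outgoing guards are $[0,\infty)$ and it has no outgoing transport arc. **Inclusion ordering.** Let $P_{inc}\subseteq P$. For a symbolic marking $M=(\pi,W)$, $W$ a set of valuations, $\mathrm{inc}(M)$ is the set of tokens $i$ with $\pi(i)\in P_{inc}$, $\iota(\pi(i))=[0,\infty)$, no inhibitor arc out of $\pi(i)$, and either $\pi(i)$ untimed or, with $V_i=\{v(i)\mid v\in W\}$, $mc(\pi(i))<\inf V_i$ in case $\inf V_i\in V_i$ and $mc(\pi(i))\le\inf V_i$ in case $\inf V_i\notin V_i$. Let $\mathrm{eq}(M)$ be the set of the other tokens outside $\bot$. Then $M\sqsubseteq M'=(\pi',W')$ if each $p\in P$ contains at most as many tokens of $\mathrm{inc}(M)$ in $M$ as of $\mathrm{inc}(M')$ in $M'$, and there is a bijection $h:\mathrm{eq}(M)\to\mathrm{eq}(M')$ with $\pi(i)=\pi'(h(i))$ such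 that for each $v\in W$ there is $v'\in W'$ with, for all $i\in\mathrm{eq}(M)$, $v(i)=v'(h(i))$ or both $v(i)>mc(\pi(i))$ and $v'(h(i))>mc(\pi'(h(i)))$. **Extrapolation.** A difference bound matrix (DBM) $D$ over the clocks $0,1,\dots,k$ (clock $0$ always has value $0$) has entries $(m,<)$, $(m,\le)$, $m\in\mathbb Z$, or $(\infty,<)$, with $D_{0i}\le0$, $D_{i0}\ge0$ (constants) and $D_{ii}=(0,\le)$; $[D]$ is the set of valuations with $v(i)-v(j)\lhd m$ for all entries $D_{ij}=(m,\lhd)$; $D$ is canonical if $D_{ij}\preceq D_{il}+D_{lj}$ for all $i,j,l$. With $D_{0i}=(-l_i,\lhd)$, the extrapolation $\mathrm{ext}_\pi(D)$ changes, for $i\ne j$ in $\{1,\dots,k\}$: $D_{0i}$ to $(-mc(\pi(i)),<)$ if $mc(\pi(i))<l_i$; $D_{i0}$ to $(\infty,<)$ if $mc(\pi(i))<l_i$ or the constant of $D_{i0}$ exceeds $mc(\pi(i))$; $D_{ij}$ to $(\infty,<)$ if $mc(\pi(i))<l_i$ or $mc(\pi(j))<l_j$ or the constant of $D_{ij}$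 exceeds $mc(\pi(i))$. For a placement $\pi$ and a DBM $D$ let $\mathrm{close}_\pi(D)$ be the canonical form of $\mathrm{ext}_\pi(D'')$, where $D''$ is the canonical DBM of $\{v+d\mid v\in[D],d\ge0\}\cap I(\pi)$ and $I(\pi)=\{v\mid v(i)\in\iota(\pi(i))\text{ for all }i\}$. The successors $\mathrm{succ}(\pi,D)$ are the $(\pi',\mathrm{close}_{\pi'}(D'))$ for all $t$ and $IN$ with $\mathrm{pre}(t)=\{\pi(i)\mid i\in IN\}$ and no token outside $IN$ in a place with an inhibitor arc to $t$, where $\pi'=\mathrm{move}(\pi,IN,t)$ and $D'$ is the canonical DBM of $\big([D]\cap\{v\mid v(i)\in c(\pi(i),t)\text{ for }i\in IN\}\big)[R]\cap I(\pi')$, provided that this set is non-empty. **Algorithm.** Put $S_0=(\pi_0,\mathrm{close}_{\pi_0}(D_0))$ with $[D_0]=\{v_0\}$. If $S_0\models\psi$ return YES. Otherwise let PASSED $=\emptyset$, WAITING $=\{S_0\}$. While WAITING $\neq\emptyset$: move some $M$ from WAITING to PASSED, and for each $M'\in\mathrm{succ}(M)$, in any order, if no $M''\in$ PASSED $\cup$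 WAITING has $M'\sqsubseteq M''$, remove all $M''\sqsubseteq M'$ from PASSED and from WAITING, return YES if $M'\models\psi$, and add $M'$ to WAITING. If WAITING becomes empty, return NO. (Pairs $(\pi,D)$ are compared as $(\pi,[D])$.) **Claim.** Let $(N,(\pi_0,v_0))$ be a marked $k$-bounded TAPN, $\psi$ a predicate and $P_{inc}\subseteq P$ a set that contains no place that is monotonicity-breaking in $\psi$. If $(\pi_0,v_0)\models\mathrm{EF}\,\psi$, then the algorithm terminates and returns YES, for every order in which the markings of WAITING and the successors are chosen. -/

import Mathlib

noncomputable section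

namespace TimedArc

open scoped Classical NNReal

/-! ### Time intervals -/

/-- Time intervals `[a,a]`, `[a,b]`, `[a,b)`, `(a,b]`, `(a,b)`, `[a,∞)`, `(a,∞)` with natural
number end points, `a < b`. -/
inductive Interval where
  | point (a : ℕ)
  | cc (a b : ℕ) (h : a < b)
  | co (a b : ℕ) (h : a < b)
  | oc (a b : ℕ) (h : a < b)
  | oo (a b : ℕ) (h : a < b)
  | ci (a : ℕ)
  | oi (a : ℕ)

namespace Interval

/-- The set of ages described by an interval. -/
def toSet : Interval → Set ℝ≥0
  | point a => {x | x = a}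
  | cc a b _ => {x | a ≤ x ∧ x ≤ b}
  | co a b _ => {x | a ≤ x ∧ x < b}
  | oc a b _ => {x | a < x ∧ x ≤ b}
  | oo a b _ => {x | a < x ∧ x < b}
  | ci a => {x | a ≤ x}
  | oi a => {x | a < x}

/-- The largest constant different from `∞` in the interval. -/
def mci : Interval → ℕ
  | point a => a
  | cc _ b _ => b
  | co _ b _ => b
  | oc _ b _ => b
  | oo _ b _ => b
  | ci a => a
  | oi a => a

/-- The interval `[0,∞)`. -/
def all : Interval := ci 0

end Interval

/-! ### Timed-arc Petri nets -/

inductive ArcType where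
  | normal
  | inhib
  | transport (l : ℕ)

/-- A timed-arc Petri net with finite sets `P` of places and `T` of transitions.
The functions `c`, `inType`, `outType` are total for convenience; only their values on arcs are
ever used. -/
structure TAPN (P T : Type*) [Fintype P] [Fintype T] where
  /-- input arcs -/
  IA : Finset (P × T)
  /-- output arcs -/
  OA : Finset (T × P)
  /-- guards of the input arcs -/
  c : P → T → Interval
  /-- types of the input arcs -/
  inType : P → T → ArcType
  /-- types of the output arcs -/
  outType : T → P → ArcType
  /-- age invariants of the places -/
  inv : P → Interval
  inhib_guard : ∀ p t, (p, t) ∈ IA → inType p t = .inhib → c p t = Interval.all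
  out_not_inhib : ∀ t p, (t, p) ∈ OA → outType t p ≠ .inhib
  transport_in : ∀ p t l, (p, t) ∈ IA → inType p t = .transport l →
    ∃! p', (t, p') ∈ OA ∧ outType t p' = .transport l
  transport_out : ∀ t p' l, (t, p') ∈ OA → outType t p' = .transport l →
    ∃! p, (p, t) ∈ IA ∧ inType p t = .transport l
  inv_zero : ∀ p, 0 ∈ (inv p).toSet

/-- Placements of `k` tokens; `none` is the pseudo-place `⊥` that holds the unused tokens. -/
abbrev Placement (P : Type*) (k : ℕ) := Fin k → Option P

/-- Valuations of the clocks `1, …, k`, that is, age functions of the `k` tokens. The value of the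
pseudo-clock `𝟎` is always `0`, see `clockValue`. -/
abbrev Valuation (k : ℕ) := Fin k → ℝ≥0

/-- A marking: a placement of the tokens and their ages. -/
abbrev Marking (P : Type*) (k : ℕ) := Placement P k × Valuation k

/-- A symbolic marking: a placement and a set of valuations. -/
abbrev SymMarking (P : Type*) (k : ℕ) := Placement P k × Set (Valuation k)

/-- `v + d` -/
def delay {k : ℕ} (v : Valuation k) (d : ℝ≥0) : Valuation k := fun i => v i + d

/-- `v[R]`: the clocks in `R` are set to `0`. -/
def reset {k : ℕ} (v : Valuation k) (R : Set (Fin k)) : Valuation k :=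
  fun i => if i ∈ R then 0 else v i

/-- `cnt π X p`: the number of tokens of `X` in the place `p`. -/
def cnt {P : Type*} {k : ℕ} (π : Placement P k) (X : Set (Fin k)) (p : P) : ℕ :=
  (Finset.univ.filter fun i => i ∈ X ∧ π i = some p).card

namespace TAPN

variable {P T : Type*} [Fintype P] [Fintype T] (N : TAPN P T)

/-- Input places of `t`, inhibitor arcs excluded. -/
def preset (t : T) : Finset P :=
  Finset.univ.filter fun p => (p, t) ∈ N.IA ∧ N.inType p t ≠ .inhib

/-- Output places of `t`. -/
def postset (t : T) : Finset P := Finset.univ.filter fun p => (t, p) ∈ N.OA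

/-- The size of the augmented preset and postset of `t`. -/
def width (t : T) : ℕ := max (N.preset t).card (N.postset t).card

/-- The preset as a multiset, padded with copies of `⊥` to the size `width t`. -/
def augPreset (t : T) : Multiset (Option P) :=
  (N.preset t).val.map some + Multiset.replicate (N.width t - (N.preset t).card) none

/-- The postset as a multiset, padded with copies of `⊥` to the size `width t`. -/
def augPostset (t : T) : Multiset (Option P) :=
  (N.postset t).val.map some + Multiset.replicate (N.width t - (N.postset t).card) none

/-- The guards `c`, extended by `c(⊥,t) = [0,∞)`. -/
def guard : Option P → T → Interval
  | none, _ => Interval.all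
  | some p, t => N.c p t

/-- The invariants, extended by `ι(⊥) = [0,∞)`. -/
def invariant : Option P → Interval
  | none => Interval.all
  | some p => N.inv p

/-- There is a transport arc from the place `x` to `t` (never the case for `x = ⊥`). -/
def IsTransport (x : Option P) (t : T) : Prop :=
  ∃ p l, x = some p ∧ (p, t) ∈ N.IA ∧ N.inType p t = .transport l

/-- There is an inhibitor arc from the place `x` to `t` (never the case for `x = ⊥`). -/
def IsInhibitor (x : Option P) (t : T) : Prop :=
  ∃ p, x = some p ∧ (p, t) ∈ N.IA ∧ N.inType p t = .inhib

/-- A pairing function: it fixes for each transition the routes from the elements of its augmented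
preset to those of its augmented postset; the two ends of a transport route are paired. -/
structure Pairing where
  pairs : T → Finset (Option P × Option P)
  map_fst : ∀ t, (pairs t).val.map Prod.fst = N.augPreset t
  map_snd : ∀ t, (pairs t).val.map Prod.snd = N.augPostset t
  transport : ∀ t, ∀ x ∈ pairs t, ∀ y ∈ pairs t, ∀ p p' l,
    x.1 = some p → (p, t) ∈ N.IA → N.inType p t = .transport l →
    y.2 = some p' → (t, p') ∈ N.OA → N.outType t p' = .transport l → x = y

variable {N}

/-- `π'` results from `π` by moving the tokens of `IN` along the pairs of `Pairing(t)`: for some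
enumeration of the pairs `(p₁,p₁'), …, (p_ℓ,p_ℓ')` by the tokens `i₁, …, i_ℓ` of `IN`, the token
`i_j` is in `p_j` and is moved to `p_j'`. -/
def IsMove (pr : N.Pairing) {k : ℕ} (π : Placement P k) (IN : Finset (Fin k)) (t : T)
    (π' : Placement P k) : Prop :=
  (∃ e : {i // i ∈ IN} ≃ {x // x ∈ pr.pairs t},
    ∀ i, π i.1 = (e i).1.1 ∧ π' i.1 = (e i).1.2) ∧
  ∀ i, i ∉ IN → π' i = π i

/-- A function `move(π, IN, t)`. It is determined up to the choice which of the tokens of `IN` in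
`⊥` goes to which of the places that are paired with `⊥`; any choice is allowed. -/
structure MoveFun (pr : N.Pairing) (k : ℕ) where
  move : Placement P k → Finset (Fin k) → T → Placement P k
  isMove : ∀ π IN t, IN.val.map π = N.augPreset t → IsMove pr π IN t (move π IN t)

variable (N)

/-- The tokens whose ages are reset when `t` is fired by the tokens `IN`. -/
def resetSet {k : ℕ} (π : Placement P k) (IN : Finset (Fin k)) (t : T) : Set (Fin k) :=
  {i | i ∈ IN ∧ ¬ N.IsTransport (π i) t}

variable {N}

/-! ### Concrete semantics -/

/-- `t` is enabled in `(π, v)` by the tokens `IN`, which it moves so that the placement becomes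
`π'`. -/
def Enabled (pr : N.Pairing) {k : ℕ} (M : Marking P k) (IN : Finset (Fin k)) (t : T)
    (π' : Placement P k) : Prop :=
  IN.val.map M.1 = N.augPreset t ∧
  IsMove pr M.1 IN t π' ∧
  (∀ i ∈ IN, M.2 i ∈ (N.guard (M.1 i) t).toSet) ∧
  (∀ i ∈ IN, N.IsTransport (M.1 i) t → M.2 i ∈ (N.invariant (π' i)).toSet) ∧
  (∀ i, i ∉ IN → ¬ N.IsInhibitor (M.1 i) t)

/-- The labelled transition relation of the net: firing of transitions and time delays. -/
inductive Step (pr : N.Pairing) {k : ℕ} : Marking P k → T ⊕ ℝ≥0 → Marking P k → Prop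
  | fire (M : Marking P k) (t : T) (IN : Finset (Fin k)) (π' : Placement P k)
      (h : Enabled pr M IN t π') :
      Step pr M (Sum.inl t) (π', reset M.2 (N.resetSet M.1 IN t))
  | delay (M : Marking P k) (d : ℝ≥0)
      (h : ∀ i, M.2 i + d ∈ (N.invariant (M.1 i)).toSet) :
      Step pr M (Sum.inr d) (M.1, delay M.2 d)

/-- `M →* M'` -/
def Reaches (pr : N.Pairing) {k : ℕ} : Marking P k → Marking P k → Prop :=
  Relation.ReflTransGen fun M M' => ∃ a, Step pr M a M'

/-- The initial marking with placement `π₀`: all ages are `0`. -/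
def initMarking {k : ℕ} (π₀ : Placement P k) : Marking P k := (π₀, fun _ => 0)

/-- The net with the initial placement `π₀` is `k`-bounded: however many additional unused tokens
are supplied in `⊥`, no reachable marking has more than `k` tokens outside `⊥`. (A marking with
`k` tokens in all has trivially at most `k` of them outside `⊥`, so that boundedness of the net has
to be expressed with a supply of tokens that is not limited in advance.) -/
def Bounded (pr : N.Pairing) {k : ℕ} (π₀ : Placement P k) : Prop :=
  ∀ (n : ℕ) (M : Marking P (k + n)),
    Reaches pr (initMarking (Fin.append π₀ fun _ : Fin n => none)) M →
    (Finset.univ.filter fun i => M.1 i ≠ none).card ≤ k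

/-! ### Maximum constants -/

variable (N)

/-- The maximum constant in guards and invariants of the net. -/
def gc : ℕ :=
  max (N.IA.sup fun a => (N.c a.1 a.2).mci) (Finset.univ.sup fun p => (N.inv p).mci)

/-- The maximum constant of a place. -/
def mc : Option P → ℕ
  | none => 0
  | some p =>
    if ∃ t, N.IsTransport (some p) t then N.gc
    else max (N.inv p).mci
      ((Finset.univ.filter fun t => (p, t) ∈ N.IA).sup fun t => (N.c p t).mci)

/-- The ages of the tokens in `p` are irrelevant. -/
def Untimed (p : P) : Prop :=
  N.inv p = Interval.all ∧
  ∀ t, (p, t) ∈ N.IA → ¬ N.IsTransport (some p) t ∧ N.c p t = Interval.all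

/-! ### The inclusion ordering -/

/-- The tokens of `M` eligible for inclusion checking. -/
def INC {k : ℕ} (M : SymMarking P k) : Set (Fin k) :=
  {i | ∃ p, M.1 i = some p ∧
    N.inv p = Interval.all ∧
    (∀ t, ¬ N.IsInhibitor (some p) t) ∧
    (N.Untimed p ∨
      let V : Set ℝ≥0 := {x | ∃ v ∈ M.2, x = v i}
      (sInf V ∈ V → (N.mc (some p) : ℝ≥0) < sInf V) ∧
      (sInf V ∉ V → (N.mc (some p) : ℝ≥0) ≤ sInf V))}

/-- The tokens checked for inclusion, for a set `Pinc` of inclusion places. -/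
def incTokens (Pinc : Set P) {k : ℕ} (M : SymMarking P k) : Set (Fin k) :=
  N.INC M ∩ {i | ∃ p ∈ Pinc, M.1 i = some p}

/-- The unused tokens. -/
def botTokens {k : ℕ} (M : SymMarking P k) : Set (Fin k) := {i | M.1 i = none}

/-- The tokens checked for equality. -/
def eqTokens (Pinc : Set P) {k : ℕ} (M : SymMarking P k) : Set (Fin k) :=
  (botTokens M ∪ N.incTokens Pinc M)ᶜ

/-- `M ⊑ M'`, the inclusion ordering of symbolic markings. -/
def Included (Pinc : Set P) {k : ℕ} (M M' : SymMarking P k) : Prop :=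
  (∃ h : {i // i ∈ N.eqTokens Pinc M} ≃ {i // i ∈ N.eqTokens Pinc M'},
    (∀ i, M.1 i.1 = M'.1 (h i).1) ∧
    ∀ v ∈ M.2, ∃ v' ∈ M'.2, ∀ i,
      v i.1 = v' (h i).1 ∨
      ((N.mc (M.1 i.1) : ℝ≥0) < v i.1 ∧ (N.mc (M'.1 (h i).1) : ℝ≥0) < v' (h i).1)) ∧
  ∀ p, cnt M.1 (N.incTokens Pinc M) p ≤ cnt M'.1 (N.incTokens Pinc M') p

end TAPN

/-! ### Difference bound matrices -/

/-- Bounds: `(∞,<)`, and `(m,<)` (`strict = true`) and `(m,≤)` (`strict = false`), `m ∈ ℤ`. -/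
inductive Bound where
  | inf
  | fin (m : ℤ) (strict : Bool)

namespace Bound

/-- `x ◁ m` for a bound `(m,◁)`. -/
def Holds : Bound → ℝ → Prop
  | inf, _ => True
  | fin m true, x => x < m
  | fin m false, x => x ≤ m

/-- The order `⪯` of bounds; `(m,<) ⪯ (m,≤)`. -/
def Le : Bound → Bound → Prop
  | _, inf => True
  | inf, fin _ _ => False
  | fin m s, fin n t => m < n ∨ (m = n ∧ (t = true → s = true))

/-- Addition of bounds. -/
def add : Bound → Bound → Bound
  | fin m s, fin n t => fin (m + n) (s || t)
  | _, _ => inf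

/-- The constant of the bound is greater than `c`. -/
def Exceeds : Bound → ℤ → Prop
  | inf, _ => True
  | fin m _, c => c < m

end Bound

/-- The clocks `𝟎, 1, …, k`; the pseudo-clock `𝟎` is `none`. -/
abbrev Clock (k : ℕ) := Option (Fin k)

/-- The value of a clock; the pseudo-clock has the value `0`. -/
def clockValue {k : ℕ} (v : Valuation k) : Clock k → ℝ
  | none => 0
  | some i => v i

/-- Difference bound matrices over the clocks `𝟎, 1, …, k`. -/
structure DBM (k : ℕ) where
  bd : Clock k → Clock k → Bound
  lower : ∀ i, ∃ m s, bd none i = .fin m s ∧ m ≤ 0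
  upper : ∀ i m s, bd i none = .fin m s → 0 ≤ m
  diag : ∀ i, bd i i = .fin 0 false

namespace DBM

variable {k : ℕ}

instance : Nonempty (DBM k) :=
  ⟨{ bd := fun i j => if i = none ∨ i = j then .fin 0 false else .inf
     lower := fun i => ⟨0, false, by simp, le_refl 0⟩
     upper := by
       intro i m s h
       by_cases hi : i = none
       · simp [hi] at h; omega
       · simp [hi] at h
     diag := fun i => by simp }⟩

/-- The zone `[D]`: the set of solutions of `D`. -/
def zone (D : DBM k) : Set (Valuation k) :=
  {v | ∀ i j, (D.bd i j).Holds (clockValue v i - clockValue v j)}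

/-- `D` is in canonical form. -/
def Canonical (D : DBM k) : Prop :=
  ∀ i j l, (D.bd i j).Le ((D.bd i l).add (D.bd l j))

/-- The canonical DBM with zone `W`, for a non-empty set `W` of valuations that is the zone of some
DBM. The operations on DBMs (delay, reset, intersection, canonical form) are the ones that return
the canonical DBM of the resulting zone. -/
def canonicalOf (W : Set (Valuation k)) : DBM k :=
  Classical.epsilon fun D => D.Canonical ∧ D.zone = W

/-- The constant of the lower bound `-m ◁ v(i)` of the clock `i`, where `(m,◁)` is the entry of `D`
at `(𝟎,i)` (this entry is never `(∞,<)`). -/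
def lbConst (D : DBM k) (i : Fin k) : ℤ :=
  match D.bd none (some i) with
  | .fin m _ => -m
  | .inf => 0

/-- The extrapolation of `D` for the maximum constants `c i` of the clocks. -/
def extrapolate (c : Fin k → ℕ) (D : DBM k) : DBM k where
  bd
    | none, none => D.bd none none
    | none, some i =>
      if (c i : ℤ) < D.lbConst i then .fin (-(c i : ℤ)) true else D.bd none (some i)
    | some i, none =>
      if (c i : ℤ) < D.lbConst i ∨ (D.bd (some i) none).Exceeds (c i) then .inf
      else D.bd (some i) none
    | some i, some j =>
      if i ≠ j ∧ ((c i : ℤ) < D.lbConst i ∨ (c j : ℤ) < D.lbConst j ∨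
          (D.bd (some i) (some j)).Exceeds (c i)) then .inf
      else D.bd (some i) (some j)
  lower := by
    rintro (_ | i)
    · exact D.lower none
    · by_cases h : (c i : ℤ) < D.lbConst i
      · exact ⟨-(c i : ℤ), true, by simp [h], by omega⟩
      · simpa [h] using D.lower (some i)
  upper := by
    rintro (_ | i) m s h
    · exact D.upper none m s h
    · refine D.upper (some i) m s ?_
      dsimp only at h
      split_ifs at h
      exact h
  diag := by
    rintro (_ | i)
    · exact D.diag none
    · simpa using D.diag (some i)

end DBM

/-! ### Properties -/

inductive Cmp where
  | lt | le | eq | ne | ge | gt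

def Cmp.Holds : Cmp → ℕ → ℕ → Prop
  | lt, a, b => a < b
  | le, a, b => a ≤ b
  | eq, a, b => a = b
  | ne, a, b => a ≠ b
  | ge, a, b => a ≥ b
  | gt, a, b => a > b

/-- The boolean predicates `ψ ::= p ⋈ n | ψ ∧ ψ | ψ ∨ ψ`. -/
inductive Predicate (P : Type*) where
  | atom (p : P) (r : Cmp) (n : ℕ)
  | and (φ ψ : Predicate P)
  | or (φ ψ : Predicate P)

namespace Predicate

variable {P : Type*}

/-- `M ⊨ ψ`; this depends only on the placement of `M`. -/
def Sat {k : ℕ} (π : Placement P k) : Predicate P → Prop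
  | atom p r n => r.Holds (cnt π Set.univ p) n
  | and φ ψ => φ.Sat π ∧ ψ.Sat π
  | or φ ψ => φ.Sat π ∨ ψ.Sat π

/-- `p` is monotonicity-breaking in `ψ`: some atom of `ψ` is of the form
`p < n`, `p ≤ n`, `p = n` or `p ≠ n`. -/
def Breaking (p : P) : Predicate P → Prop
  | atom q r _ => q = p ∧ (r = .lt ∨ r = .le ∨ r = .eq ∨ r = .ne)
  | and φ ψ => φ.Breaking p ∨ ψ.Breaking p
  | or φ ψ => φ.Breaking p ∨ ψ.Breaking p

end Predicate

namespace TAPN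

variable {P T : Type*} [Fintype P] [Fintype T] {N : TAPN P T}

/-- `M ⊨ EF ψ` -/
def SatEF (pr : N.Pairing) {k : ℕ} (M : Marking P k) (ψ : Predicate P) : Prop :=
  ∃ M', Reaches pr M M' ∧ ψ.Sat M'.1

/-! ### The reachability algorithm -/

/-- Symbolic markings as represented in the algorithm. -/
abbrev DBMMarking (P : Type*) (k : ℕ) := Placement P k × DBM k

/-- The symbolic marking `(π, [D])`. -/
def DBMMarking.sym {k : ℕ} (M : DBMMarking P k) : SymMarking P k := (M.1, M.2.zone)

variable (N) in
/-- The valuations that satisfy the invariants of all tokens. -/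
def invZone {k : ℕ} (π : Placement P k) : Set (Valuation k) :=
  {v | ∀ i, v i ∈ (N.invariant (π i)).toSet}

variable (N) in
/-- The valuations in which the tokens of `IN` satisfy the guards of `t`. -/
def guardZone {k : ℕ} (π : Placement P k) (IN : Finset (Fin k)) (t : T) : Set (Valuation k) :=
  {v | ∀ i ∈ IN, v i ∈ (N.guard (π i) t).toSet}

variable (N) in
/-- `([D] ∩ ⋂ [D_{i ∈ c(π(i),t)}])[R] ∩ ⋂ [D_{i ∈ ι(π'(i))}]` -/
def fireZone {k : ℕ} (M : DBMMarking P k) (IN : Finset (Fin k)) (t : T) (π' : Placement P k) :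
    Set (Valuation k) :=
  ((fun v => reset v (N.resetSet M.1 IN t)) '' (M.2.zone ∩ N.guardZone M.1 IN t)) ∩ N.invZone π'

/-- `W↑` -/
def delayZone {k : ℕ} (W : Set (Valuation k)) : Set (Valuation k) :=
  {w | ∃ v ∈ W, ∃ d : ℝ≥0, w = delay v d}

variable (N) in
/-- `ext_π (D↑ ∩ ⋂ D_{i ∈ ι(π(i))})ᶜ`, the canonical form of the extrapolation, in the placement
`π`, of the delay of `D` subject to the invariants. -/
def delayExtrapolate {k : ℕ} (π : Placement P k) (D : DBM k) : DBM k :=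
  DBM.canonicalOf (DBM.extrapolate (fun i => N.mc (π i))
    (DBM.canonicalOf (delayZone D.zone ∩ N.invZone π))).zone

/-- The output of the successor generation algorithm. The requirement that `fireZone` is non-empty
is the consistency check of the algorithm. -/
def succ {pr : N.Pairing} {k : ℕ} (mv : MoveFun pr k) (M : DBMMarking P k) :
    Set (DBMMarking P k) :=
  {M' | ∃ (t : T) (IN : Finset (Fin k)),
    IN.val.map M.1 = N.augPreset t ∧
    (∀ i, i ∉ IN → ¬ N.IsInhibitor (M.1 i) t) ∧
    (N.fireZone M IN t (mv.move M.1 IN t)).Nonempty ∧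
    M' = (mv.move M.1 IN t, N.delayExtrapolate (mv.move M.1 IN t)
      (DBM.canonicalOf (N.fireZone M IN t (mv.move M.1 IN t))))}

variable (N) in
/-- The first symbolic marking explored by the algorithm. -/
def initState {k : ℕ} (π₀ : Placement P k) : DBMMarking P k :=
  (π₀, N.delayExtrapolate π₀ (DBM.canonicalOf {fun _ => 0}))

/-- Configurations of the reachability algorithm. -/
inductive Config (P : Type*) (k : ℕ) where
  /-- before the initial test -/
  | start
  /-- at the head of the while loop -/
  | loop (passed waiting : Set (DBMMarking P k))
  /-- in the inner loop, with the set of successors still to be treated -/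
  | inner (todo passed waiting : Set (DBMMarking P k))
  /-- the algorithm has returned YES (`true`) or NO (`false`) -/
  | done (answer : Bool)

/-- The steps of the reachability algorithm. The choice of the next element of the waiting list and
the order in which the successors are treated are nondeterministic. -/
inductive AlgStep {pr : N.Pairing} {k : ℕ} (mv : MoveFun pr k) (π₀ : Placement P k)
    (Pinc : Set P) (ψ : Predicate P) : Config P k → Config P k → Prop
  | startYes (h : ψ.Sat (N.initState π₀).1) :
      AlgStep mv π₀ Pinc ψ .start (.done true)
  | startLoop (h : ¬ ψ.Sat (N.initState π₀).1) :
      AlgStep mv π₀ Pinc ψ .start (.loop ∅ {N.initState π₀})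
  | exit (passed : Set (DBMMarking P k)) :
      AlgStep mv π₀ Pinc ψ (.loop passed ∅) (.done false)
  | take (passed waiting : Set (DBMMarking P k)) (M : DBMMarking P k) (h : M ∈ waiting) :
      AlgStep mv π₀ Pinc ψ (.loop passed waiting)
        (.inner (succ mv M) (passed ∪ {M}) (waiting \ {M}))
  | back (passed waiting : Set (DBMMarking P k)) :
      AlgStep mv π₀ Pinc ψ (.inner ∅ passed waiting) (.loop passed waiting)
  | discard (todo passed waiting : Set (DBMMarking P k)) (M : DBMMarking P k) (h : M ∈ todo)
      (hinc : ∃ M' ∈ passed ∪ waiting, N.Included Pinc M.sym M'.sym) :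
      AlgStep mv π₀ Pinc ψ (.inner todo passed waiting) (.inner (todo \ {M}) passed waiting)
  | found (todo passed waiting : Set (DBMMarking P k)) (M : DBMMarking P k) (h : M ∈ todo)
      (hinc : ¬ ∃ M' ∈ passed ∪ waiting, N.Included Pinc M.sym M'.sym)
      (hsat : ψ.Sat M.1) :
      AlgStep mv π₀ Pinc ψ (.inner todo passed waiting) (.done true)
  | add (todo passed waiting : Set (DBMMarking P k)) (M : DBMMarking P k) (h : M ∈ todo)
      (hinc : ¬ ∃ M' ∈ passed ∪ waiting, N.Included Pinc M.sym M'.sym)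
      (hsat : ¬ ψ.Sat M.1) :
      AlgStep mv π₀ Pinc ψ (.inner todo passed waiting)
        (.inner (todo \ {M})
          (passed \ {M' | N.Included Pinc M'.sym M.sym})
          ((waiting \ {M' | N.Included Pinc M'.sym M.sym}) ∪ {M}))

/-- `ReturnsFrom step a s`: every run of `step` from `s` is finite and ends in `a`. -/
inductive ReturnsFrom {S : Type*} (step : S → S → Prop) (a : S) : S → Prop
  | final : ReturnsFrom step a a
  | next (s : S) (hex : ∃ s', step s s') (hall : ∀ s', step s s' → ReturnsFrom step a s') :
      ReturnsFrom step a s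

/-- The reachability algorithm, started with the initial placement `π₀`, the inclusion places
`Pinc` and the property `EF ψ`, terminates and returns YES, whatever its nondeterministic choices
are. -/
def ReturnsYes {pr : N.Pairing} {k : ℕ} (mv : MoveFun pr k) (π₀ : Placement P k)
    (Pinc : Set P) (ψ : Predicate P) : Prop :=
  ReturnsFrom (AlgStep mv π₀ Pinc ψ) (.done true) .start

end TAPN

end TimedArc

end

/-!
Reachability is decided correctly because concrete runs are simulated by the symbolic markings in
the lists of the algorithm, and because only finitely many symbolic markings can occur.

**Zones.** The least difference bounds that hold on a non-empty zone form a canonical matrix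
(`IsZone.exists_canonical`), and partial solutions of canonical matrices extend to solutions
(`DBM.Canonical.exists_extension`, by Helly's theorem on the line). Hence delays and resets of zones
are zones, so that the matrices computed by the algorithm do represent the intended sets. The
extrapolation only adds valuations that agree with old ones up to ages above the maximum constants
(`DBM.Canonical.exists_mem_zone`). To see this, fix the ages that do not exceed their maximum
constants; the bound `x > c i` for one further clock `i` is compatible with the canonical matrix,
and all these bounds are met at once because zones are closed under pointwise suprema. The bounds of
extrapolated matrices are limited, whence finiteness (`DBM.finite_extrapolate`).

**Soundness.** Ages that are equal or both above the maximum constant of a place cannot be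
distinguished by the net (`TAPN.AgeSim`). Up to this relation, every valuation of an explored
symbolic marking belongs to a reachable concrete marking, whatever number of unused tokens is
supplied (`TAPN.IsState.succ`). This is where boundedness enters: a symbolic marking always has
enough unused tokens to fire a transition that it enables otherwise, since the firing could be
carried out with additional tokens (`TAPN.Realizable.width_sub_le`).

**Simulation.** A symbolic marking covers a concrete one if the tokens of the latter correspond to
tokens of the former in the same places and of indistinguishable ages, all surplus tokens being
inclusion tokens (`TAPN.Covers`). Surplus tokens do not interfere with invariants or inhibitor arcs
and remain inclusion tokens until they are moved. So covering is preserved by delays and firings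
(`TAPN.Covers.delay`, `TAPN.Covers.fire`), it is monotone for `⊑` (`TAPN.Covers.mono`), and it
preserves the property (`TAPN.Covers.sat`).

**The algorithm.** All successors of passed symbolic markings stay below the lists, so that with an
empty waiting list the passed ones would cover every reachable marking, among them one that
satisfies the property; hence NO is never returned (`TAPN.LoopInv.not_satEF`). As `⊑` is transitive,
the set of symbolic markings below the lists never shrinks, and it grows whenever one is added; as
it is finite, every run ends (`TAPN.LoopInv.returnsFrom`).
-/

noncomputable section

namespace TimedArc

open scoped Classical NNReal

/-! ### Bounds -/

namespace Bound

lemma Holds.of_le {b b' : Bound} (h : b.Le b') {x : ℝ} (hx : b.Holds x) : b'.Holds x := by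
  rcases b' with _ | ⟨n, t⟩
  · trivial
  rcases b with _ | ⟨m, s⟩
  · exact h.elim
  rcases h with h | ⟨rfl, h⟩
  · have : (m : ℝ) < n := by exact_mod_cast h
    cases s <;> cases t <;> simp only [Holds] at * <;> linarith
  · cases s <;> cases t <;> simp_all [Holds]
    exact hx.le

lemma Holds.anti {b : Bound} {x y : ℝ} (hy : b.Holds y) (h : x ≤ y) : b.Holds x := by
  rcases b with _ | ⟨m, _ | _⟩ <;> simp only [Holds] at * <;> linarith

lemma Holds.add {b b' : Bound} {x y : ℝ} (hx : b.Holds x) (hy : b'.Holds y) :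
    (b.add b').Holds (x + y) := by
  rcases b with _ | ⟨m, _ | _⟩ <;> rcases b' with _ | ⟨n, _ | _⟩ <;>
    simp only [Holds, Bound.add, Bool.or_true, Bool.or_false, Int.cast_add] at * <;> linarith

/-- The half-lines `b.Holds (a - x)` and `b'.Holds (x - c)` meet if the sum of the two bounds
holds for the difference of their end points. -/
lemma exists_holds_sub {b b' : Bound} {a c : ℝ} (h : (b.add b').Holds (a - c)) :
    ∃ x, b.Holds (a - x) ∧ b'.Holds (x - c) := by
  rcases b with _ | ⟨m, s⟩ <;> rcases b' with _ | ⟨n, t⟩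
  · exact ⟨0, trivial, trivial⟩
  · refine ⟨c + n - 1, trivial, ?_⟩
    cases t <;> simp only [Holds] <;> linarith
  · refine ⟨a - m + 1, ?_, trivial⟩
    cases s <;> simp only [Holds] <;> linarith
  · refine ⟨((a - m) + (c + n)) / 2, ?_⟩
    cases s <;> cases t <;>
      simp only [Holds, Bound.add, Bool.or_true, Bool.or_false, Int.cast_add] at * <;>
      constructor <;> linarith

lemma convex_holds_sub_left (b : Bound) (a : ℝ) : Convex ℝ {x | b.Holds (a - x)} :=
  Set.OrdConnected.convex ⟨fun x hx _ _ z hz => by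
    simp only [Set.mem_ofPred_eq] at *
    exact hx.anti (by linarith [hz.1])⟩

lemma convex_holds_sub_right (b : Bound) (c : ℝ) : Convex ℝ {x | b.Holds (x - c)} :=
  Set.OrdConnected.convex ⟨fun _ _ y hy z hz => by
    simp only [Set.mem_ofPred_eq] at *
    exact hy.anti (by linarith [hz.2])⟩

lemma exists_holds (b : Bound) : ∃ x, ∀ y ≤ x, b.Holds y := by
  rcases b with _ | ⟨m, s⟩
  · exact ⟨0, fun _ _ => trivial⟩
  · refine ⟨m - 1, fun y hy => ?_⟩
    cases s <;> simp only [Holds] <;> linarith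

/-- Helly's theorem on the line for half-lines given by bounds: a finite system of lower bounds
`b i` relative to `a i` and upper bounds `b' i` relative to `c i` is solvable if each lower bound
is compatible with each upper bound. -/
lemma exists_forall_holds {ι : Type*} (s : Finset ι) (a c : ι → ℝ) (b b' : ι → Bound)
    (h : ∀ i ∈ s, ∀ j ∈ s, ((b i).add (b' j)).Holds (a i - c j)) :
    ∃ x, ∀ i ∈ s, (b i).Holds (a i - x) ∧ (b' i).Holds (x - c i) := by
  let F : ι × Bool → Set ℝ := fun p =>
    if p.2 then {x | (b p.1).Holds (a p.1 - x)} else {x | (b' p.1).Holds (x - c p.1)}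
  have hconv : ∀ p, Convex ℝ (F p) := by
    rintro ⟨i, _ | _⟩
    · exact convex_holds_sub_right _ _
    · exact convex_holds_sub_left _ _
  have hpair : ∀ p ∈ s ×ˢ (Finset.univ : Finset Bool), ∀ q ∈ s ×ˢ (Finset.univ : Finset Bool),
      (F p ∩ F q).Nonempty := by
    rintro ⟨i, x⟩ hi ⟨j, y⟩ hj
    simp only [Finset.mem_product, Finset.mem_univ, and_true] at hi hj
    cases x <;> cases y
    · obtain ⟨r, hr⟩ := exists_holds (b' i)
      obtain ⟨r', hr'⟩ := exists_holds (b' j)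
      exact ⟨min (r + c i) (r' + c j), hr _ (by linarith [min_le_left (r + c i) (r' + c j)]),
        hr' _ (by linarith [min_le_right (r + c i) (r' + c j)])⟩
    · obtain ⟨z, h1, h2⟩ := exists_holds_sub (h j hj i hi)
      exact ⟨z, h2, h1⟩
    · obtain ⟨z, h1, h2⟩ := exists_holds_sub (h i hi j hj)
      exact ⟨z, h1, h2⟩
    · obtain ⟨r, hr⟩ := exists_holds (b i)
      obtain ⟨r', hr'⟩ := exists_holds (b j)
      exact ⟨max (a i - r) (a j - r'), hr _ (by linarith [le_max_left (a i - r) (a j - r')]),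
        hr' _ (by linarith [le_max_right (a i - r) (a j - r')])⟩
  obtain ⟨x, hx⟩ := Convex.helly_theorem' (𝕜 := ℝ) (F := F)
    (s := s ×ˢ (Finset.univ : Finset Bool)) (fun p _ => hconv p) (by
      intro I hI hcard
      rw [Module.finrank_self] at hcard
      have : I.card = 0 ∨ I.card = 1 ∨ I.card = 2 := by omega
      rcases this with h0 | h1 | h2
      · rw [Finset.card_eq_zero] at h0
        subst h0
        exact ⟨0, by simp⟩
      · obtain ⟨p, rfl⟩ := Finset.card_eq_one.1 h1
        have hp := hI (Finset.mem_singleton_self p)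
        obtain ⟨x, hx, -⟩ := hpair p hp p hp
        exact ⟨x, by simpa using hx⟩
      · obtain ⟨p, q, -, rfl⟩ := Finset.card_eq_two.1 h2
        obtain ⟨x, hx⟩ := hpair p (hI (by simp)) q (hI (by simp))
        exact ⟨x, by simpa using hx⟩)
  simp only [Set.mem_iInter] at hx
  exact ⟨x, fun i hi => ⟨by simpa [F] using hx (i, true) (by simp [hi]),
    by simpa [F] using hx (i, false) (by simp [hi])⟩⟩

/-- A non-empty set of reals has a least bound. -/
lemma exists_least {X : Set ℝ} (hX : X.Nonempty) :
    ∃ b : Bound, (∀ x ∈ X, b.Holds x) ∧ ∀ b' : Bound, (∀ x ∈ X, b'.Holds x) → b.Le b' := by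
  have weaken : ∀ n t, (∀ x ∈ X, (fin n t).Holds x) → ∀ x ∈ X, (fin n false).Holds x := by
    intro n t h x hx
    exact Holds.of_le (b := fin n t) (b' := fin n false) (Or.inr ⟨rfl, by simp⟩) (h x hx)
  by_cases hfin : ∃ n : ℤ, ∀ x ∈ X, (fin n false).Holds x
  · obtain ⟨x₀, hx₀⟩ := hX
    obtain ⟨m, hm, hmin⟩ := Int.exists_least_of_bdd
      (P := fun n : ℤ => ∀ x ∈ X, (fin n false).Holds x)
      ⟨⌊x₀⌋, fun n hn => by
        have h1 : x₀ ≤ n := hn x₀ hx₀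
        exact_mod_cast (Int.floor_le x₀).trans h1⟩ hfin
    by_cases hs : ∀ x ∈ X, (fin m true).Holds x
    · refine ⟨fin m true, hs, ?_⟩
      rintro (_ | ⟨n, t⟩) h
      · trivial
      · rcases (hmin n (weaken n t h)).lt_or_eq with h1 | h1
        · exact Or.inl h1
        · exact Or.inr ⟨h1, fun _ => rfl⟩
    · refine ⟨fin m false, hm, ?_⟩
      rintro (_ | ⟨n, t⟩) h
      · trivial
      · rcases (hmin n (weaken n t h)).lt_or_eq with h1 | h1
        · exact Or.inl h1
        · refine Or.inr ⟨h1, fun ht => ?_⟩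
          subst h1 ht
          exact absurd h hs
  · refine ⟨inf, fun _ _ => trivial, ?_⟩
    rintro (_ | ⟨n, t⟩) h
    · trivial
    · exact absurd ⟨n, weaken n t h⟩ hfin

end Bound

/-! ### Zones and canonical difference bound matrices -/

variable {k : ℕ}

/-- A zone: the solution set of a system of difference bounds on the clocks `𝟎, 1, …, k`. The
system need not be a matrix, so that intersections of zones are zones for trivial reasons. -/
def IsZone (W : Set (Valuation k)) : Prop :=
  ∃ C : Set (Clock k × Clock k × Bound),
    W = {v | ∀ c ∈ C, c.2.2.Holds (clockValue v c.1 - clockValue v c.2.1)}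

@[simp] lemma clockValue_none (v : Valuation k) : clockValue v none = 0 := rfl

@[simp] lemma clockValue_some (v : Valuation k) (i : Fin k) : clockValue v (some i) = v i := rfl

lemma clockValue_nonneg (v : Valuation k) (i : Clock k) : 0 ≤ clockValue v i := by
  cases i <;> simp

lemma IsZone.single (i j : Clock k) (b : Bound) :
    IsZone {v : Valuation k | b.Holds (clockValue v i - clockValue v j)} :=
  ⟨{(i, j, b)}, by simp⟩

lemma IsZone.iInter {ι : Sort*} {W : ι → Set (Valuation k)} (h : ∀ a, IsZone (W a)) :
    IsZone (⋂ a, W a) := by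
  choose C hC using h
  refine ⟨⋃ a, C a, ?_⟩
  ext v
  simp only [Set.mem_iInter, Set.mem_iUnion, Set.mem_ofPred_eq, hC]
  exact ⟨fun h c ⟨a, ha⟩ => h a c ha, fun h a c hc => h c ⟨a, hc⟩⟩

lemma IsZone.forall {ι : Sort*} {p : ι → Valuation k → Prop} (h : ∀ a, IsZone {v | p a v}) :
    IsZone {v | ∀ a, p a v} := by
  rw [Set.ofPred_forall]
  exact .iInter h

lemma IsZone.inter {W W' : Set (Valuation k)} (h : IsZone W) (h' : IsZone W') :
    IsZone (W ∩ W') := by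
  rw [Set.inter_eq_iInter]
  exact .iInter fun b => by cases b <;> simpa

lemma DBM.isZone (D : DBM k) : IsZone D.zone :=
  .forall fun i => .forall fun j => .single i j _

lemma isZone_lower (i : Fin k) (a : ℕ) :
    IsZone {v : Valuation k | (a : ℝ≥0) ≤ v i} := by
  convert IsZone.single none (some i) (.fin (-(a : ℤ)) false) using 4 with v
  rw [← NNReal.coe_le_coe]
  simp [Bound.Holds]

lemma isZone_lower_strict (i : Fin k) (a : ℕ) :
    IsZone {v : Valuation k | (a : ℝ≥0) < v i} := by
  convert IsZone.single none (some i) (.fin (-(a : ℤ)) true) using 4 with v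
  rw [← NNReal.coe_lt_coe]
  simp [Bound.Holds]

lemma isZone_upper (i : Fin k) (a : ℕ) :
    IsZone {v : Valuation k | v i ≤ (a : ℝ≥0)} := by
  convert IsZone.single (some i) none (.fin (a : ℤ) false) using 4 with v
  rw [← NNReal.coe_le_coe]
  simp [Bound.Holds]

lemma isZone_upper_strict (i : Fin k) (a : ℕ) :
    IsZone {v : Valuation k | v i < (a : ℝ≥0)} := by
  convert IsZone.single (some i) none (.fin (a : ℤ) true) using 4 with v
  rw [← NNReal.coe_lt_coe]
  simp [Bound.Holds]

lemma isZone_interval (i : Fin k) (I : Interval) : IsZone {v : Valuation k | v i ∈ I.toSet} := by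
  cases I with
  | point a =>
    convert (isZone_lower i a).inter (isZone_upper i a) using 1
    ext v
    simp only [Interval.toSet, Set.mem_ofPred_eq, Set.mem_inter_iff]
    rw [le_antisymm_iff, and_comm]
  | cc a b _ => exact (isZone_lower i a).inter (isZone_upper i b)
  | co a b _ => exact (isZone_lower i a).inter (isZone_upper_strict i b)
  | oc a b _ => exact (isZone_lower_strict i a).inter (isZone_upper i b)
  | oo a b _ => exact (isZone_lower_strict i a).inter (isZone_upper_strict i b)
  | ci a => exact isZone_lower i a
  | oi a => exact isZone_lower_strict i a

/-- The least bounds that hold on a non-empty zone form a canonical matrix of this zone. -/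
lemma IsZone.exists_canonical {W : Set (Valuation k)} (hW : IsZone W) (hne : W.Nonempty) :
    ∃ D : DBM k, D.Canonical ∧ D.zone = W := by
  obtain ⟨v₀, hv₀⟩ := hne
  have hleast : ∀ i j : Clock k, ∃ b : Bound,
      (∀ v ∈ W, b.Holds (clockValue v i - clockValue v j)) ∧
      ∀ b' : Bound, (∀ v ∈ W, b'.Holds (clockValue v i - clockValue v j)) → b.Le b' := by
    intro i j
    obtain ⟨b, hb, hmin⟩ := Bound.exists_least
      (X := (fun v : Valuation k => clockValue v i - clockValue v j) '' W) ⟨_, v₀, hv₀, rfl⟩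
    exact ⟨b, fun v hv => hb _ ⟨v, hv, rfl⟩,
      fun b' hb' => hmin b' (by rintro _ ⟨v, hv, rfl⟩; exact hb' v hv)⟩
  choose B hB hmin using hleast
  refine ⟨⟨B, fun i => ?_, fun i m s h => ?_, fun i => ?_⟩, fun i j l => ?_, ?_⟩
  · have h := hmin none i (.fin 0 false) fun v _ => by
      simp [Bound.Holds, clockValue_nonneg]
    rcases hb : B none i with _ | ⟨m, s⟩ <;> rw [hb] at h
    · exact h.elim
    · refine ⟨m, s, rfl, ?_⟩
      rcases h with h | h
      · exact h.le
      · exact h.1.le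
  · have h1 := hB i none v₀ hv₀
    rw [h] at h1
    have h2 := clockValue_nonneg v₀ i
    have : (0 : ℝ) ≤ m := by
      cases s <;> simp only [Bound.Holds, clockValue_none] at h1 <;> linarith
    exact_mod_cast this
  · have h := hmin i i (.fin 0 false) fun v _ => by simp [Bound.Holds]
    have h1 := hB i i v₀ hv₀
    rcases hb : B i i with _ | ⟨m, s⟩ <;> rw [hb] at h h1
    · exact h.elim
    · rw [sub_self] at h1
      have h2 : m ≤ 0 := by
        rcases h with h | h
        · exact h.le
        · exact h.1.le
      have h2' : (m : ℝ) ≤ 0 := by exact_mod_cast h2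
      cases s with
      | true => exact absurd h1 (not_lt.2 h2')
      | false =>
        have h3 : (0 : ℝ) ≤ m := h1
        have : (m : ℝ) = 0 := le_antisymm h2' h3
        rw [show m = 0 by exact_mod_cast this]
  · refine hmin i j _ fun v hv => ?_
    have := (hB i l v hv).add (hB l j v hv)
    rwa [sub_add_sub_cancel] at this
  · obtain ⟨C, rfl⟩ := hW
    ext v
    refine ⟨fun hv c hc => ?_, fun hv i j => hB i j v hv⟩
    exact (hv c.1 c.2.1).of_le (hmin c.1 c.2.1 c.2.2 fun v hv => hv c hc)

lemma canonicalOf_spec {W : Set (Valuation k)} (hW : IsZone W) (hne : W.Nonempty) :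
    (DBM.canonicalOf W).Canonical ∧ (DBM.canonicalOf W).zone = W :=
  Classical.epsilon_spec (hW.exists_canonical hne)

namespace DBM

/-- One clock can be added to a partial solution of a canonical matrix. -/
lemma Canonical.exists_value {D : DBM k} (hD : D.Canonical) (S : Finset (Clock k)) (u : Clock k → ℝ)
    (h : ∀ i ∈ S, ∀ j ∈ S, (D.bd i j).Holds (u i - u j)) (l : Clock k) :
    ∃ x, ∀ j ∈ S, (D.bd j l).Holds (u j - x) ∧ (D.bd l j).Holds (x - u j) :=
  Bound.exists_forall_holds S u u (fun j => D.bd j l) (fun j => D.bd l j)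
    fun i hi j hj => (h i hi j hj).of_le (hD i j l)

/-- A partial solution of a canonical matrix extends to a solution. -/
lemma Canonical.exists_extension {D : DBM k} (hD : D.Canonical) (S : Finset (Clock k))
    (hS : none ∈ S) (u : Clock k → ℝ) (hu : u none = 0)
    (h : ∀ i ∈ S, ∀ j ∈ S, (D.bd i j).Holds (u i - u j)) :
    ∃ v ∈ D.zone, ∀ i, some i ∈ S → (v i : ℝ) = u (some i) := by
  have key : ∀ R : Finset (Clock k), ∃ u' : Clock k → ℝ, (∀ i ∈ S, u' i = u i) ∧
      ∀ i ∈ S ∪ R, ∀ j ∈ S ∪ R, (D.bd i j).Holds (u' i - u' j) := by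
    intro R
    induction R using Finset.induction_on with
    | empty => exact ⟨u, fun _ _ => rfl, by simpa using h⟩
    | insert l R _ ih =>
      obtain ⟨u', hu', hsol⟩ := ih
      by_cases hl : l ∈ S ∪ R
      · refine ⟨u', hu', ?_⟩
        rwa [Finset.union_insert, Finset.insert_eq_of_mem hl]
      obtain ⟨x, hx⟩ := hD.exists_value _ u' hsol l
      have hne : ∀ i ∈ S ∪ R, i ≠ l := fun i hi e => hl (e ▸ hi)
      refine ⟨Function.update u' l x, fun i hi => ?_, ?_⟩
      · rw [Function.update_of_ne (hne i (Finset.mem_union_left _ hi)), hu' i hi]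
      · rw [Finset.union_insert]
        intro i hi j hj
        rcases Finset.mem_insert.1 hi with hi' | hi' <;>
          rcases Finset.mem_insert.1 hj with hj' | hj'
        · rw [hi', hj', sub_self, D.diag]
          simp [Bound.Holds]
        · rw [hi', Function.update_self, Function.update_of_ne (hne j hj')]
          exact (hx j hj').2
        · rw [hj', Function.update_self, Function.update_of_ne (hne i hi')]
          exact (hx i hi').1
        · rw [Function.update_of_ne (hne i hi'), Function.update_of_ne (hne j hj')]
          exact hsol i hi' j hj'
  obtain ⟨u', hu', hsol⟩ := key Finset.univ
  have h0 : u' none = 0 := (hu' none hS).trans hu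
  have hnonneg : ∀ i, 0 ≤ u' i := by
    intro i
    obtain ⟨m, s, hb, hm⟩ := D.lower i
    have h1 := hsol none (by simp) i (by simp)
    rw [hb, h0] at h1
    have : (m : ℝ) ≤ 0 := by exact_mod_cast hm
    cases s <;> simp only [Bound.Holds] at h1 <;> linarith
  have hval : ∀ i, clockValue (fun i => (⟨u' (some i), hnonneg _⟩ : ℝ≥0)) i = u' i := by
    rintro (_ | i)
    · exact h0.symm
    · rfl
  refine ⟨fun i => ⟨u' (some i), hnonneg _⟩, fun i j => ?_, fun i hi => hu' _ hi⟩
  rw [hval, hval]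
  exact hsol i (by simp) j (by simp)

end DBM

/-! ### Closure properties of zones -/

lemma isZone_zero : IsZone {(fun _ => 0 : Valuation k)} := by
  convert IsZone.forall fun i : Fin k => isZone_upper i 0 using 1
  ext v
  simp [funext_iff]

/-- The time successors of a zone form a zone: the upper bounds of a canonical matrix are
dropped. -/
lemma isZone_delayZone {W : Set (Valuation k)} (hW : IsZone W) (hne : W.Nonempty) :
    IsZone (TAPN.delayZone W) := by
  obtain ⟨D, hD, rfl⟩ := hW.exists_canonical hne
  have : TAPN.delayZone D.zone = {v | ∀ i j : Clock k, ∀ _ : j ≠ none ∨ i = none,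
      (D.bd i j).Holds (clockValue v i - clockValue v j)} := by
    ext w
    constructor
    · rintro ⟨v, hv, d, rfl⟩ (_ | i) (_ | j) h
      · exact hv _ _
      · refine (hv none (some j)).anti ?_
        simp [delay]
      · simp at h
      · refine (hv (some i) (some j)).anti ?_
        simp [delay]
    · intro hw
      obtain ⟨d, hd⟩ := Bound.exists_forall_holds (Finset.univ : Finset (Clock k))
        (clockValue w) (clockValue w) (fun i => D.bd i none)
        -- the pair `(𝟎, 𝟎)` contributes only the lower bound `0 ≤ d`
        (fun j => if j = none then .inf else D.bd none j) (by
          intro i _ j _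
          rcases j with _ | j
          · simp only [if_true]
            cases D.bd i none <;> trivial
          · simpa using (hw i (some j) (by simp)).of_le (hD i (some j) none))
      have hd0 : 0 ≤ d := by
        have := (hd none (by simp)).1
        rw [D.diag] at this
        simpa [Bound.Holds] using this
      have hle : ∀ i, d ≤ w i := by
        intro i
        have h1 := (hd (some i) (by simp)).2
        obtain ⟨m, s, hb, hm⟩ := D.lower (some i)
        rw [if_neg (by simp), hb] at h1
        have : (m : ℝ) ≤ 0 := by exact_mod_cast hm
        cases s <;> simp only [Bound.Holds, clockValue_some] at h1 <;> linarith
      lift d to ℝ≥0 using hd0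
      have hcv : ∀ i, ((w i - d : ℝ≥0) : ℝ) = w i - d := fun i => NNReal.coe_sub (hle i)
      refine ⟨fun i => w i - d, ?_, d, ?_⟩
      · rintro (_ | i) (_ | j)
        · simpa using hw none none (by simp)
        · have := (hd (some j) (by simp)).2
          rw [if_neg (by simp)] at this
          simpa [hcv] using this
        · have := (hd (some i) (by simp)).1
          simpa [hcv] using this
        · have := hw (some i) (some j) (by simp)
          simpa [hcv] using this
      · funext i
        exact (tsub_add_cancel_of_le (NNReal.coe_le_coe.1 (hle i))).symm
  rw [this]
  exact .forall fun i => .forall fun j => .forall fun _ => .single i j _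

/-- The image of a zone under a reset is a zone: the bounds of a canonical matrix on the clocks
that are reset are replaced by the value `0`. -/
lemma isZone_reset {W : Set (Valuation k)} (hW : IsZone W) (hne : W.Nonempty) (R : Set (Fin k)) :
    IsZone ((fun v => reset v R) '' W) := by
  obtain ⟨D, hD, rfl⟩ := hW.exists_canonical hne
  let S : Finset (Clock k) := Finset.univ.filter fun i => ∀ a, i = some a → a ∉ R
  have : (fun v => reset v R) '' D.zone = {v | ∀ a, ∀ _ : a ∈ R, v a ≤ ((0 : ℕ) : ℝ≥0)} ∩
      {v | ∀ i j, ∀ _ : i ∈ S ∧ j ∈ S, (D.bd i j).Holds (clockValue v i - clockValue v j)} := by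
    have hcv : ∀ v : Valuation k, ∀ i ∈ S, clockValue (reset v R) i = clockValue v i := by
      rintro v (_ | i) hi
      · rfl
      · simp [reset, (Finset.mem_filter.1 hi).2 i rfl]
    ext w
    constructor
    · rintro ⟨v, hv, rfl⟩
      refine ⟨fun a ha => by simp [reset, ha], fun i j h => ?_⟩
      rw [hcv v i h.1, hcv v j h.2]
      exact hv i j
    · rintro ⟨h0, h1⟩
      obtain ⟨v, hv, he⟩ := hD.exists_extension S (by simp [S]) (clockValue w) rfl
        fun i hi j hj => h1 i j ⟨hi, hj⟩
      refine ⟨v, hv, ?_⟩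
      funext i
      by_cases hi : i ∈ R
      · simpa [reset, hi, eq_comm] using h0 i hi
      · have := he i (by simp [S, hi])
        simpa [reset, hi] using this
  rw [this]
  exact .inter (.forall fun a => .forall fun _ => isZone_upper a 0)
    (.forall fun i => .forall fun j => .forall fun _ => .single i j _)

section Net

variable {P T : Type*} [Fintype P] [Fintype T] (N : TAPN P T)

lemma isZone_invZone (π : Placement P k) : IsZone (N.invZone π) :=
  .forall fun i => isZone_interval i _

lemma isZone_guardZone (π : Placement P k) (IN : Finset (Fin k)) (t : T) :
    IsZone (N.guardZone π IN t) :=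
  .forall fun i => .forall fun _ => isZone_interval i _

lemma isZone_fireZone (M : TAPN.DBMMarking P k) (IN : Finset (Fin k)) (t : T) (π' : Placement P k)
    (hne : (N.fireZone M IN t π').Nonempty) : IsZone (N.fireZone M IN t π') := by
  refine .inter (isZone_reset (M.2.isZone.inter (isZone_guardZone N M.1 IN t)) ?_ _)
    (isZone_invZone N π')
  obtain ⟨_, ⟨v, hv, -⟩, -⟩ := hne
  exact ⟨v, hv⟩

end Net

/-! ### Extrapolation -/

namespace DBM

variable (c : Fin k → ℕ) (D : DBM k)

lemma exists_bd_none_some (i : Fin k) :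
    ∃ s, D.bd none (some i) = .fin (-D.lbConst i) s ∧ 0 ≤ D.lbConst i := by
  obtain ⟨m, s, h, hm⟩ := D.lower (some i)
  refine ⟨s, ?_, ?_⟩ <;> simp only [lbConst, h, neg_neg]
  omega

lemma extrapolate_none_some (i : Fin k) : (D.extrapolate c).bd none (some i) =
    if (c i : ℤ) < D.lbConst i then .fin (-(c i : ℤ)) true else D.bd none (some i) := rfl

lemma extrapolate_some_none (i : Fin k) : (D.extrapolate c).bd (some i) none =
    if (c i : ℤ) < D.lbConst i ∨ (D.bd (some i) none).Exceeds (c i) then .inf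
    else D.bd (some i) none := rfl

lemma extrapolate_some_some (i j : Fin k) : (D.extrapolate c).bd (some i) (some j) =
    if i ≠ j ∧ ((c i : ℤ) < D.lbConst i ∨ (c j : ℤ) < D.lbConst j ∨
      (D.bd (some i) (some j)).Exceeds (c i)) then .inf
    else D.bd (some i) (some j) := rfl

lemma zone_subset_extrapolate : D.zone ⊆ (D.extrapolate c).zone := by
  rintro v hv (_ | i) (_ | j)
  · exact hv none none
  · rw [extrapolate_none_some]
    split_ifs with h
    · obtain ⟨s, hs, -⟩ := D.exists_bd_none_some j
      have h1 := hv none (some j)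
      rw [hs] at h1
      have h2 : ((c j : ℤ) : ℝ) < D.lbConst j := by exact_mod_cast h
      cases s <;> simp only [Bound.Holds] at * <;> push_cast at * <;> linarith
    · exact hv none (some j)
  · rw [extrapolate_some_none]
    split_ifs
    · trivial
    · exact hv _ _
  · rw [extrapolate_some_some]
    split_ifs
    · trivial
    · exact hv _ _

/-- Zones are closed under pointwise suprema. -/
lemma sup_mem_zone {v w : Valuation k} (hv : v ∈ D.zone) (hw : w ∈ D.zone) : v ⊔ w ∈ D.zone := by
  have hcv : ∀ i, clockValue (v ⊔ w) i = max (clockValue v i) (clockValue w i) := by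
    rintro (_ | i)
    · simp
    · exact NNReal.coe_max _ _
  intro i j
  rw [hcv, hcv]
  rcases le_total (clockValue v i) (clockValue w i) with h | h
  · rw [max_eq_right h]
    exact (hw i j).anti (by linarith [le_max_right (clockValue v j) (clockValue w j)])
  · rw [max_eq_left h]
    exact (hv i j).anti (by linarith [le_max_left (clockValue v j) (clockValue w j)])

variable {c D}

lemma not_lt_lbConst {v : Valuation k} (hv : v ∈ (D.extrapolate c).zone) {i : Fin k}
    (hi : v i ≤ c i) : ¬ (c i : ℤ) < D.lbConst i := by
  intro h
  have h1 := hv none (some i)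
  rw [extrapolate_none_some, if_pos h] at h1
  have h2 : (v i : ℝ) ≤ c i := by exact_mod_cast hi
  simp only [Bound.Holds, clockValue_none, clockValue_some] at h1
  push_cast at h1
  linarith

/-- On the clocks that do not exceed their maximum constants, a solution of the extrapolated
matrix is a partial solution of the original matrix. -/
lemma holds_of_mem_extrapolate {v : Valuation k} (hv : v ∈ (D.extrapolate c).zone) {i j : Clock k}
    (hi : ∀ a, i = some a → v a ≤ c a) (hj : ∀ a, j = some a → v a ≤ c a) :
    (D.bd i j).Holds (clockValue v i - clockValue v j) := by
  have h := hv i j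
  have exceeds : ∀ (b : Bound) (a : Fin k) (x : ℝ), b.Exceeds (c a) → x ≤ v a → v a ≤ c a →
      b.Holds x := by
    rintro (_ | ⟨m, s⟩) a x hb hx ha
    · trivial
    · have h1 : ((c a : ℤ) : ℝ) < m := by exact_mod_cast hb
      have h2 : (v a : ℝ) ≤ c a := by exact_mod_cast ha
      push_cast at h1
      cases s <;> simp only [Bound.Holds] <;> linarith
  rcases i with _ | i <;> rcases j with _ | j
  · exact h
  · rwa [extrapolate_none_some, if_neg (not_lt_lbConst hv (hj j rfl))] at h
  · have hi' := hi i rfl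
    rw [extrapolate_some_none] at h
    split_ifs at h with hc
    · rcases hc with hc | hc
      · exact absurd hc (not_lt_lbConst hv hi')
      · exact exceeds _ i _ hc (by simp) hi'
    · exact h
  · have hi' := hi i rfl
    rw [extrapolate_some_some] at h
    split_ifs at h with hc
    · rcases hc.2 with hc | hc | hc
      · exact absurd hc (not_lt_lbConst hv hi')
      · exact absurd hc (not_lt_lbConst hv (hj j rfl))
      · exact exceeds _ i _ hc (by simp) hi'
    · exact h

/-- For a clock `i` above its maximum constant, the bound `x > c i` is compatible with the upper
bounds for `i` relative to the clocks that do not exceed their maximum constants. -/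
lemma Canonical.holds_above (hD : D.Canonical) {v : Valuation k}
    (hv : v ∈ (D.extrapolate c).zone) {i : Fin k} (hi : c i < v i) {j : Clock k}
    (hj : ∀ a, j = some a → v a ≤ c a) :
    ((Bound.fin (-(c i : ℤ)) true).add (D.bd (some i) j)).Holds (0 - clockValue v j) := by
  have hci : (c i : ℝ) < v i := by exact_mod_cast hi
  have hvj := clockValue_nonneg v j
  rcases hb : D.bd (some i) j with _ | ⟨m, s⟩
  · trivial
  simp only [Bound.add, Bound.Holds, Bool.true_or]
  push_cast
  by_contra hcon
  have hm : (m : ℝ) ≤ c i - clockValue v j := by linarith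
  have hmc : ¬ (c i : ℤ) < m := by
    intro h
    have : ((c i : ℤ) : ℝ) < m := by exact_mod_cast h
    push_cast at this
    linarith
  obtain ⟨s', hs', -⟩ := D.exists_bd_none_some i
  have hcan := hD none j (some i)
  rw [hs', hb] at hcan
  -- if the lower bound of `i` exceeds its maximum constant, it forces `D.bd (some i) j` up
  have hlb : (c i : ℤ) < D.lbConst i → False := by
    intro h
    have h' : ((c i : ℤ) : ℝ) < D.lbConst i := by exact_mod_cast h
    have h1 := (holds_of_mem_extrapolate hv (i := none) (j := j) (by simp) hj).of_le hcan
    simp only [Bound.add, clockValue_none] at h1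
    push_cast at h'
    cases hss : (s' || s) <;> rw [hss] at h1 <;> simp only [Bound.Holds] at h1 <;>
      push_cast at h1 <;> linarith
  have hle : ¬ (Bound.fin m s).Holds (v i - clockValue v j) := by
    cases s <;> simp only [Bound.Holds] <;> linarith
  apply hle
  have h := hv (some i) j
  rcases j with _ | j
  · rw [extrapolate_some_none, hb, if_neg (by simpa [Bound.Exceeds] using ⟨not_lt.1 hlb,
      not_lt.1 hmc⟩)] at h
    exact h
  · have hj' := not_lt_lbConst hv (hj j rfl)
    rw [extrapolate_some_some, hb, if_neg] at h
    · exact h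
    · rintro ⟨-, h | h | h⟩
      · exact hlb h
      · exact hj' h
      · exact hmc h

/-- Soundness of the extrapolation: each solution of the extrapolated matrix agrees with one of
the original matrix up to changes of ages above the maximum constants. -/
lemma Canonical.exists_mem_zone (hD : D.Canonical) {v : Valuation k}
    (hv : v ∈ (D.extrapolate c).zone) :
    ∃ v' ∈ D.zone, ∀ i, v i = v' i ∨ (c i < v i ∧ c i < v' i) := by
  let S : Finset (Clock k) := Finset.univ.filter fun i => ∀ a, i = some a → v a ≤ c a
  have hS : ∀ {i}, i ∈ S ↔ ∀ a, i = some a → v a ≤ c a := by simp [S]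
  have hnone : none ∈ S := by simp [S]
  -- a solution that exceeds the maximum constant of one prescribed clock
  have one : ∀ i, c i < v i → ∃ v' ∈ D.zone, (∀ j, v j ≤ c j → v' j = v j) ∧ c i < v' i := by
    intro i hi
    have hiS : some i ∉ S := fun h => absurd (hS.1 h i rfl) (not_le.2 hi)
    obtain ⟨x, hx⟩ := Bound.exists_forall_holds (insert none (S.image some))
      (fun o => o.elim 0 (clockValue v)) (fun o => o.elim 0 (clockValue v))
      (fun o => o.elim (.fin (-(c i : ℤ)) true) fun j => D.bd j (some i))
      (fun o => o.elim .inf fun j => D.bd (some i) j) (by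
        intro a ha b hb
        rcases b with _ | b
        · rcases a with _ | a
          · trivial
          · simp only [Option.elim]
            cases D.bd a (some i) <;> trivial
        · have hb' : b ∈ S := by simpa using hb
          rcases a with _ | a
          · exact hD.holds_above hv hi (hS.1 hb')
          · have ha' : a ∈ S := by simpa using ha
            exact (holds_of_mem_extrapolate hv (hS.1 ha') (hS.1 hb')).of_le (hD a b (some i)))
    have hxi : (c i : ℝ) < x := by
      have := (hx none (by simp)).1
      simp only [Option.elim, Bound.Holds] at this
      push_cast at this
      linarith
    have hne : ∀ j ∈ S, j ≠ some i := fun j hj e => hiS (e ▸ hj)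
    obtain ⟨v', hv', he⟩ := hD.exists_extension (insert (some i) S) (by simp [hnone])
      (Function.update (clockValue v) (some i) x) (by simp) (by
        intro a ha b hb
        rcases Finset.mem_insert.1 ha with ha' | ha' <;>
          rcases Finset.mem_insert.1 hb with hb' | hb'
        · rw [ha', hb', sub_self, D.diag]
          simp [Bound.Holds]
        · rw [ha', Function.update_self, Function.update_of_ne (hne b hb')]
          exact (hx (some b) (by simpa using hb')).2
        · rw [hb', Function.update_self, Function.update_of_ne (hne a ha')]
          exact (hx (some a) (by simpa using ha')).1
        · rw [Function.update_of_ne (hne a ha'), Function.update_of_ne (hne b hb')]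
          exact holds_of_mem_extrapolate hv (hS.1 ha') (hS.1 hb'))
    refine ⟨v', hv', fun j hj => ?_, ?_⟩
    · have hjS : some j ∈ S := hS.2 (by rintro _ ⟨⟩; exact hj)
      have := he j (by simp [hjS])
      rw [Function.update_of_ne (hne _ hjS), clockValue_some] at this
      exact_mod_cast this
    · have := he i (by simp)
      rw [Function.update_self] at this
      rw [← this] at hxi
      exact_mod_cast hxi
  -- pointwise suprema handle all clocks at once
  have all : ∀ B : Finset (Fin k), (∀ i ∈ B, c i < v i) →
      ∃ v' ∈ D.zone, (∀ j, v j ≤ c j → v' j = v j) ∧ ∀ i ∈ B, c i < v' i := by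
    intro B
    induction B using Finset.induction_on with
    | empty =>
      intro _
      obtain ⟨v', hv', he⟩ := hD.exists_extension S hnone (clockValue v) rfl
        fun i hi j hj => holds_of_mem_extrapolate hv (hS.1 hi) (hS.1 hj)
      refine ⟨v', hv', fun j hj => ?_, by simp⟩
      have := he j (hS.2 (by rintro _ ⟨⟩; exact hj))
      rw [clockValue_some] at this
      exact_mod_cast this
    | insert i B _ ih =>
      intro hB
      obtain ⟨v₁, hv₁, he₁, h₁⟩ := ih fun j hj => hB j (Finset.mem_insert_of_mem hj)
      obtain ⟨v₂, hv₂, he₂, h₂⟩ := one i (hB i (Finset.mem_insert_self i B))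
      refine ⟨v₁ ⊔ v₂, D.sup_mem_zone hv₁ hv₂, fun j hj => ?_, fun j hj => ?_⟩
      · simp [he₁ j hj, he₂ j hj]
      · rcases Finset.mem_insert.1 hj with rfl | hj
        · exact h₂.trans_le le_sup_right
        · exact (h₁ j hj).trans_le le_sup_left
  obtain ⟨v', hv', he, ha⟩ := all (Finset.univ.filter fun i => c i < v i) (by simp)
  refine ⟨v', hv', fun i => ?_⟩
  rcases le_or_gt (v i) (c i) with h | h
  · exact Or.inl (he i h).symm
  · exact Or.inr ⟨h, ha i (by simp [h])⟩

lemma eq_of_bd_eq {D E : DBM k} (h : ∀ i j, D.bd i j = E.bd i j) : D = E := by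
  cases D
  cases E
  simp only [mk.injEq]
  exact funext fun i => funext fun j => h i j

variable (c) in
/-- The bounds of an extrapolated canonical matrix lie between the maximum constants and their
negatives. -/
lemma finite_extrapolate : {E : DBM k | ∃ D : DBM k, D.Canonical ∧ E = D.extrapolate c}.Finite := by
  let K : ℤ := ∑ i, (c i : ℤ)
  have hK : ∀ i, (c i : ℤ) ≤ K := fun i =>
    Finset.single_le_sum (f := fun i => (c i : ℤ)) (fun _ _ => by positivity) (Finset.mem_univ i)
  have hK0 : 0 ≤ K := Finset.sum_nonneg fun _ _ => by positivity
  let B : Set Bound := insert .inf ((fun p : ℤ × Bool => Bound.fin p.1 p.2) ''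
    (Set.Icc (-K) K ×ˢ Set.univ))
  have hB : B.Finite :=
    (((Set.finite_Icc (-K) K).prod Set.finite_univ).image _).insert _
  have memB : ∀ m s, -K ≤ m → m ≤ K → Bound.fin m s ∈ B := fun m s h h' =>
    Or.inr ⟨(m, s), ⟨⟨h, h'⟩, trivial⟩, rfl⟩
  have hfin : {f : Clock k → Clock k → Bound | ∀ i j, f i j ∈ B}.Finite := by
    have := Set.Finite.pi' (fun _ : Clock k => Set.Finite.pi' fun _ : Clock k => hB)
    exact this.subset fun f hf i j => hf i j
  refine Set.Finite.of_finite_image (f := DBM.bd) (hfin.subset ?_)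
    (fun D _ E _ h => eq_of_bd_eq fun i j => congrFun (congrFun h i) j)
  rintro _ ⟨_, ⟨D, hD, rfl⟩, rfl⟩ (_ | i) (_ | j)
  · rw [DBM.diag]
    exact memB _ _ (by omega) hK0
  · obtain ⟨s, hs, h0⟩ := D.exists_bd_none_some j
    rw [extrapolate_none_some, hs]
    have := hK j
    split_ifs
    · exact memB _ _ (by omega) (by omega)
    · exact memB _ _ (by omega) (by omega)
  · rw [extrapolate_some_none]
    have := hK i
    split_ifs with h
    · exact Or.inl rfl
    · rcases hb : D.bd (some i) none with _ | ⟨m, s⟩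
      · exact Or.inl rfl
      · have := D.upper _ _ _ hb
        rw [hb] at h
        simp only [Bound.Exceeds, not_or, not_lt] at h
        exact memB _ _ (by omega) (by omega)
  · by_cases hij : i = j
    · subst hij
      rw [DBM.diag]
      exact memB _ _ (by omega) hK0
    rw [extrapolate_some_some]
    have := hK i
    have := hK j
    split_ifs with h
    · exact Or.inl rfl
    · rcases hb : D.bd (some i) (some j) with _ | ⟨m, s⟩
      · exact Or.inl rfl
      · rw [hb] at h
        simp only [Bound.Exceeds, not_and, not_or, not_lt] at h
        obtain ⟨h1, h2, h3⟩ := h hij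
        obtain ⟨s₁, hs₁, h₁⟩ := D.exists_bd_none_some i
        obtain ⟨s₂, hs₂, h₂⟩ := D.exists_bd_none_some j
        have hcan := hD none (some j) (some i)
        rw [hs₁, hs₂, hb] at hcan
        have : -D.lbConst j ≤ -D.lbConst i + m := by
          rcases hcan with h | h
          · exact h.le
          · exact h.1.le
        exact memB _ _ (by omega) (by omega)

end DBM

/-- The extrapolation `ext` in canonical form, applied to a zone. -/
lemma canonicalOf_extrapolate_spec (c : Fin k → ℕ) (D : DBM k) (hne : D.zone.Nonempty) :
    (DBM.canonicalOf (D.extrapolate c).zone).zone = (D.extrapolate c).zone :=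
  (canonicalOf_spec (DBM.isZone _) (hne.mono (D.zone_subset_extrapolate c))).2

/-! ### Ages that the net cannot distinguish -/

lemma Interval.mem_all (a : ℝ≥0) : a ∈ Interval.all.toSet := by
  simp [Interval.all, Interval.toSet]

lemma Interval.mem_iff_of_mci_lt {I : Interval} {a b : ℝ≥0} (ha : (I.mci : ℝ≥0) < a)
    (hb : (I.mci : ℝ≥0) < b) : a ∈ I.toSet ↔ b ∈ I.toSet := by
  cases I with
  | point _ => exact iff_of_false ha.ne' hb.ne'
  | cc _ _ _ => exact iff_of_false (fun h => ha.not_ge h.2) fun h => hb.not_ge h.2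
  | co _ _ _ => exact iff_of_false (fun h => ha.not_gt h.2) fun h => hb.not_gt h.2
  | oc _ _ _ => exact iff_of_false (fun h => ha.not_ge h.2) fun h => hb.not_ge h.2
  | oo _ _ _ => exact iff_of_false (fun h => ha.not_gt h.2) fun h => hb.not_gt h.2
  | ci _ => exact iff_of_true ha.le hb.le
  | oi _ => exact iff_of_true ha hb

namespace TAPN

variable {P T : Type*} [Fintype P] [Fintype T] (N : TAPN P T)

/-- The ages `a` and `b` of a token in `x` cannot be told apart by the net: they are equal or both
exceed the maximum constant of `x`, or ages are irrelevant in `x`. -/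
def AgeSim (x : Option P) (a b : ℝ≥0) : Prop :=
  ∀ p, x = some p → a = b ∨ ((N.mc (some p) : ℝ≥0) < a ∧ (N.mc (some p) : ℝ≥0) < b) ∨ N.Untimed p

variable {N}

lemma AgeSim.refl (x : Option P) (a : ℝ≥0) : N.AgeSim x a a := fun _ _ => Or.inl rfl

lemma AgeSim.symm {x : Option P} {a b : ℝ≥0} (h : N.AgeSim x a b) : N.AgeSim x b a := by
  intro p hp
  rcases h p hp with h | h | h
  · exact Or.inl h.symm
  · exact Or.inr (Or.inl h.symm)
  · exact Or.inr (Or.inr h)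

lemma AgeSim.trans {x : Option P} {a b c : ℝ≥0} (h : N.AgeSim x a b) (h' : N.AgeSim x b c) :
    N.AgeSim x a c := by
  intro p hp
  rcases h p hp with rfl | h | h
  · exact h' p hp
  · rcases h' p hp with rfl | h' | h'
    · exact Or.inr (Or.inl h)
    · exact Or.inr (Or.inl ⟨h.1, h'.2⟩)
    · exact Or.inr (Or.inr h')
  · exact Or.inr (Or.inr h)

lemma AgeSim.of_eq_or_mc_lt {x : Option P} {a b : ℝ≥0}
    (h : a = b ∨ ((N.mc x : ℝ≥0) < a ∧ (N.mc x : ℝ≥0) < b)) : N.AgeSim x a b := by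
  rintro p rfl
  exact h.imp_right Or.inl

lemma AgeSim.add {x : Option P} {a b : ℝ≥0} (h : N.AgeSim x a b) (d : ℝ≥0) :
    N.AgeSim x (a + d) (b + d) := by
  intro p hp
  rcases h p hp with h | h | h
  · exact Or.inl (by rw [h])
  · exact Or.inr (Or.inl ⟨h.1.trans_le le_self_add, h.2.trans_le le_self_add⟩)
  · exact Or.inr (Or.inr h)

lemma mci_inv_le_gc (p : P) : (N.inv p).mci ≤ N.gc :=
  (Finset.le_sup (f := fun p => (N.inv p).mci) (Finset.mem_univ p)).trans (le_max_right _ _)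

lemma mci_guard_le_gc {p : P} {t : T} (h : (p, t) ∈ N.IA) : (N.c p t).mci ≤ N.gc :=
  (Finset.le_sup (f := fun a : P × T => (N.c a.1 a.2).mci) h).trans (le_max_left _ _)

lemma mci_inv_le_mc (p : P) : (N.inv p).mci ≤ N.mc (some p) := by
  simp only [mc]
  split_ifs
  · exact mci_inv_le_gc p
  · exact le_max_left _ _

lemma mci_guard_le_mc {p : P} {t : T} (h : (p, t) ∈ N.IA) : (N.c p t).mci ≤ N.mc (some p) := by
  simp only [mc]
  split_ifs
  · exact mci_guard_le_gc h
  · exact (Finset.le_sup (f := fun t => (N.c p t).mci) (by simpa using h)).trans (le_max_right _ _)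

lemma mc_of_isTransport {p : P} {t : T} (h : N.IsTransport (some p) t) :
    N.mc (some p) = N.gc := if_pos ⟨t, h⟩

lemma mc_le_gc (p : P) : N.mc (some p) ≤ N.gc := by
  simp only [mc]
  split_ifs
  · exact le_rfl
  · refine max_le (mci_inv_le_gc p) (Finset.sup_le fun t ht => ?_)
    exact mci_guard_le_gc (by simpa using ht)

lemma AgeSim.mem_invariant {x : Option P} {a b : ℝ≥0} (h : N.AgeSim x a b)
    (ha : a ∈ (N.invariant x).toSet) : b ∈ (N.invariant x).toSet := by
  rcases x with _ | p
  · exact Interval.mem_all b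
  rcases h p rfl with rfl | h | h
  · exact ha
  · have hle : ((N.inv p).mci : ℝ≥0) ≤ N.mc (some p) := by exact_mod_cast mci_inv_le_mc p
    exact (Interval.mem_iff_of_mci_lt (hle.trans_lt h.1) (hle.trans_lt h.2)).1 ha
  · simp only [invariant, h.1]
    exact Interval.mem_all b

lemma AgeSim.mem_guard {x : Option P} {t : T} {a b : ℝ≥0} (h : N.AgeSim x a b)
    (hx : ∀ p, x = some p → (p, t) ∈ N.IA)
    (ha : a ∈ (N.guard x t).toSet) : b ∈ (N.guard x t).toSet := by
  rcases x with _ | p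
  · exact Interval.mem_all b
  have hp := hx p rfl
  rcases h p rfl with rfl | h | h
  · exact ha
  · have hle : ((N.c p t).mci : ℝ≥0) ≤ N.mc (some p) := by exact_mod_cast mci_guard_le_mc hp
    exact (Interval.mem_iff_of_mci_lt (hle.trans_lt h.1) (hle.trans_lt h.2)).1 ha
  · simp only [guard, (h.2 t hp).2]
    exact Interval.mem_all b

/-- Ages that are indistinguishable in the source of a transport arc are so everywhere, since the
maximum constant of such a place is the one of the net. -/
lemma AgeSim.of_isTransport {x : Option P} {t : T} {a b : ℝ≥0} (h : N.AgeSim x a b)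
    (hx : N.IsTransport x t) (y : Option P) : N.AgeSim y a b := by
  obtain ⟨p, l, rfl, hp, hl⟩ := hx
  have hpt : N.IsTransport (some p) t := ⟨p, l, rfl, hp, hl⟩
  rintro q rfl
  rcases h p rfl with h | h | h
  · exact Or.inl h
  · have hle : (N.mc (some q) : ℝ≥0) ≤ N.mc (some p) := by
      rw [mc_of_isTransport hpt]
      exact_mod_cast mc_le_gc q
    exact Or.inr (Or.inl ⟨hle.trans_lt h.1, hle.trans_lt h.2⟩)
  · exact absurd hpt (h.2 t hp).1

lemma AgeSim.mc_lt {p : P} {a b : ℝ≥0} (h : N.AgeSim (some p) a b) (hp : ¬ N.Untimed p)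
    (ha : (N.mc (some p) : ℝ≥0) < a) : (N.mc (some p) : ℝ≥0) < b := by
  rcases h p rfl with rfl | h | h
  · exact ha
  · exact h.2
  · exact absurd h hp

/-! ### Moving tokens -/

lemma card_subtype_fiber {α γ : Type*} (s : Finset α) (f : α → γ) (c : γ) :
    Fintype.card {i : {i // i ∈ s} // f i.1 = c} = (s.filter fun a => c = f a).card := by
  rw [← Fintype.card_coe]
  exact Fintype.card_congr
    ⟨fun i => ⟨i.1.1, Finset.mem_filter.2 ⟨i.1.2, i.2.symm⟩⟩,
      fun i => ⟨⟨i.1, (Finset.mem_filter.1 i.2).1⟩, (Finset.mem_filter.1 i.2).2.symm⟩,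
      fun _ => rfl, fun _ => rfl⟩

lemma exists_equiv_of_map_eq {α β γ : Type*} {s : Finset α} {t : Finset β} {f : α → γ}
    {g : β → γ} (h : s.val.map f = t.val.map g) :
    ∃ e : {i // i ∈ s} ≃ {x // x ∈ t}, ∀ i, f i.1 = g (e i).1 := by
  have hfib : ∀ c, Nonempty
      ({i : {i // i ∈ s} // f i.1 = c} ≃ {x : {x // x ∈ t} // g x.1 = c}) := by
    intro c
    refine Fintype.card_eq.1 ?_
    have := congrArg (Multiset.count c) h
    rw [Multiset.count_map, Multiset.count_map] at this
    rw [card_subtype_fiber, card_subtype_fiber]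
    exact this
  let e := fun c => (hfib c).some
  refine ⟨Equiv.ofFiberEquiv (f := fun i => f i.1) (g := fun x => g x.1) e, fun i => ?_⟩
  exact (Equiv.ofFiberEquiv_map (f := fun i : {i // i ∈ s} => f i.1)
    (g := fun x : {x // x ∈ t} => g x.1) e i).symm

lemma mem_augPreset_some {t : T} {p : P} : some p ∈ N.augPreset t ↔ p ∈ N.preset t := by
  simp [augPreset, Multiset.mem_replicate]

lemma mem_augPostset_some {t : T} {p : P} : some p ∈ N.augPostset t ↔ p ∈ N.postset t := by
  simp [augPostset, Multiset.mem_replicate]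

lemma mem_IA_of_mem_preset {t : T} {p : P} (h : p ∈ N.preset t) : (p, t) ∈ N.IA :=
  (Finset.mem_filter.1 h).2.1

/-- Only `⊥` can occur repeatedly in an augmented preset. -/
lemma eq_of_map_eq_augPreset {α : Type*} {s : Finset α} {f : α → Option P} {t : T}
    (h : s.val.map f = N.augPreset t) {i j : α} (hi : i ∈ s) (hj : j ∈ s) {p : P}
    (hfi : f i = some p) (hfj : f j = some p) : i = j := by
  have h1 : (N.augPreset t).count (some p) ≤ 1 := by
    rw [augPreset, Multiset.count_add, Multiset.count_replicate, if_neg (by simp), add_zero]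
    exact Multiset.nodup_iff_count_le_one.1
      ((N.preset t).nodup.map (Option.some_injective P)) _
  rw [← h, Multiset.count_map] at h1
  have h2 : (s.filter fun a => some p = f a).card ≤ 1 := h1
  exact Finset.card_le_one.1 h2 i (by simp [hi, hfi]) j (by simp [hj, hfj])

variable {pr : N.Pairing} {m : ℕ}

lemma exists_isMove {π : Placement P k} {IN : Finset (Fin k)} {t : T}
    (h : IN.val.map π = N.augPreset t) : ∃ π', IsMove pr π IN t π' := by
  obtain ⟨e, he⟩ := exists_equiv_of_map_eq (h.trans (pr.map_fst t).symm)
  refine ⟨fun i => if hi : i ∈ IN then (e ⟨i, hi⟩).1.2 else π i, ⟨e, fun i => ⟨he i, ?_⟩⟩,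
    fun i hi => dif_neg hi⟩
  simp

lemma IsMove.exists_equiv {π π' : Placement P k} {ρ ρ' : Placement P m} {IN : Finset (Fin k)}
    {IN' : Finset (Fin m)} {t : T} (h : IsMove pr π IN t π') (h' : IsMove pr ρ IN' t ρ') :
    ∃ σ : {i // i ∈ IN} ≃ {j // j ∈ IN'}, ∀ i, ρ (σ i).1 = π i.1 ∧ ρ' (σ i).1 = π' i.1 := by
  obtain ⟨⟨e, he⟩, -⟩ := h
  obtain ⟨⟨e', he'⟩, -⟩ := h'
  refine ⟨e.trans e'.symm, fun i => ?_⟩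
  have h1 := he' (e'.symm (e i))
  rw [Equiv.apply_symm_apply] at h1
  exact ⟨h1.1.trans (he i).1.symm, h1.2.trans (he i).2.symm⟩

lemma mem_IA_of_map_eq {π : Placement P k} {IN : Finset (Fin k)} {t : T}
    (h : IN.val.map π = N.augPreset t) {i : Fin k} (hi : i ∈ IN) {p : P} (hp : π i = some p) :
    (p, t) ∈ N.IA := by
  refine mem_IA_of_mem_preset (mem_augPreset_some.1 ?_)
  rw [← h, ← hp]
  exact Multiset.mem_map_of_mem π hi

/-- A transition that is enabled by `IN` is also enabled by any tokens in the same places with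
indistinguishable ages. -/
lemma Enabled.transfer {π π' : Placement P k} {v : Valuation k} {ρ ρ' : Placement P m}
    {w : Valuation m} {IN : Finset (Fin k)} {IN' : Finset (Fin m)} {t : T}
    (h : Enabled pr (π, v) IN t π') (hIN' : IN'.val.map ρ = N.augPreset t)
    (hmove : IsMove pr ρ IN' t ρ') (hinh : ∀ j, j ∉ IN' → ¬ N.IsInhibitor (ρ j) t)
    (hsim : ∀ i ∈ IN, ∀ j ∈ IN', ∀ p, π i = some p → ρ j = some p →
      N.AgeSim (some p) (v i) (w j)) :
    Enabled pr (ρ, w) IN' t ρ' := by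
  obtain ⟨hmap, hmove', hguard, htrans, -⟩ := h
  dsimp only at hmap hmove' hguard htrans
  obtain ⟨σ, hσ⟩ := hmove'.exists_equiv hmove
  have hs : ∀ i : {i // i ∈ IN}, N.AgeSim (π i.1) (v i.1) (w (σ i).1) := by
    intro i p hp
    exact hsim i.1 i.2 (σ i).1 (σ i).2 p hp ((hσ i).1.trans hp) p rfl
  refine ⟨hIN', hmove, fun j hj => ?_, fun j hj ht => ?_, hinh⟩
  · obtain ⟨i, hi⟩ := σ.surjective ⟨j, hj⟩
    have h1 := (hs i).mem_guard (fun p hp => mem_IA_of_map_eq hmap i.2 hp) (hguard i.1 i.2)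
    rw [← (hσ i).1, hi] at h1
    exact h1
  · obtain ⟨i, hi⟩ := σ.surjective ⟨j, hj⟩
    have h2 := hσ i
    have h3 := hs i
    rw [hi] at h2 h3
    have ht' : N.IsTransport (π i.1) t := h2.1 ▸ ht
    have h1 := (h3.of_isTransport ht' (π' i.1)).mem_invariant (htrans i.1 i.2 ht')
    change w j ∈ (N.invariant (ρ' j)).toSet
    rwa [h2.2]

/-- Tokens that are moved along the same route have indistinguishable ages afterwards. -/
lemma AgeSim.reset {π : Placement P k} {v : Valuation k} {ρ : Placement P m} {w : Valuation m}
    {IN : Finset (Fin k)} {IN' : Finset (Fin m)} {t : T} {i : Fin k} {j : Fin m}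
    (hi : i ∈ IN) (hj : j ∈ IN') (hij : ρ j = π i)
    (h : π i ≠ none → N.AgeSim (π i) (v i) (w j)) (y : Option P) :
    N.AgeSim y (reset v (N.resetSet π IN t) i) (TimedArc.reset w (N.resetSet ρ IN' t) j) := by
  by_cases ht : N.IsTransport (π i) t
  · have h1 : i ∉ N.resetSet π IN t := fun h => h.2 ht
    have h2 : j ∉ N.resetSet ρ IN' t := fun h => h.2 (hij ▸ ht)
    simp only [TimedArc.reset, h1, h2, if_false]
    refine (h ?_).of_isTransport ht y
    obtain ⟨p, _, hp, -⟩ := ht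
    simp [hp]
  · have h1 : i ∈ N.resetSet π IN t := ⟨hi, ht⟩
    have h2 : j ∈ N.resetSet ρ IN' t := ⟨hj, by rwa [hij]⟩
    simp only [TimedArc.reset, h1, h2, if_true]
    exact .refl _ _

lemma reset_of_notMem {π : Placement P k} {v : Valuation k} {IN : Finset (Fin k)} {t : T}
    {i : Fin k} (hi : i ∉ IN) : reset v (N.resetSet π IN t) i = v i :=
  if_neg fun h => hi h.1

/-- If `J` holds exactly the tokens for the proper input places, it can be completed by unused
tokens. -/
lemma map_union_eq_augPreset {π : Placement P k} {J B : Finset (Fin k)} {t : T}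
    (hJ : J.val.map π = (N.preset t).val.map some) (hB : ∀ i ∈ B, π i = none)
    (hcard : B.card = N.width t - (N.preset t).card) :
    (J ∪ B).val.map π = N.augPreset t := by
  have hdisj : Disjoint J B := by
    rw [Finset.disjoint_left]
    intro i hi hi'
    have := Multiset.mem_map_of_mem π hi
    rw [hJ, hB i hi'] at this
    simp at this
  rw [← Finset.disjUnion_eq_union J B hdisj, Finset.disjUnion_val, Multiset.map_add, hJ, augPreset,
    ← hcard]
  congr 1
  rw [Multiset.map_congr rfl hB, Multiset.map_const']
  rfl

/-! ### Placements and delays -/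

section PlacementsAndDelays

variable {Q : Type*}

/-- The placement `π` with `n` additional unused tokens. -/
def pad (π : Placement Q k) (n : ℕ) : Placement Q (k + n) := Fin.append π fun _ => none

@[simp] lemma pad_castAdd (π : Placement Q k) (n : ℕ) (i : Fin k) :
    pad π n (Fin.castAdd n i) = π i := Fin.append_left _ _ _

@[simp] lemma pad_natAdd (π : Placement Q k) (n : ℕ) (i : Fin n) :
    pad π n (Fin.natAdd k i) = none := Fin.append_right _ _ _

lemma map_pad (π : Placement Q k) (IN : Finset (Fin k)) (n : ℕ) :
    (IN.map (Fin.castAddEmb n)).val.map (pad π n) = IN.val.map π := by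
  rw [Finset.map_val, Multiset.map_map]
  exact Multiset.map_congr rfl fun i _ => pad_castAdd π n i

lemma delay_zero (v : Valuation k) : delay v 0 = v := by
  funext i
  simp [delay]

lemma delay_delay (v : Valuation k) (d e : ℝ≥0) : delay (delay v d) e = delay v (d + e) := by
  funext i
  simp [delay, add_assoc]

lemma cnt_eq_ncard (π : Placement Q k) (X : Set (Fin k)) (p : Q) :
    cnt π X p = {i | i ∈ X ∧ π i = some p}.ncard := by
  rw [cnt, ← Set.ncard_coe_finset, Finset.coe_filter]
  simp only [Finset.mem_univ, true_and]

lemma cnt_le_cnt_of_injOn {π ρ : Placement Q k} {A B : Set (Fin k)} {p : Q} (f : Fin k → Fin k)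
    (h : ∀ i ∈ A, π i = some p → f i ∈ B ∧ ρ (f i) = some p)
    (hf : Set.InjOn f {i | i ∈ A ∧ π i = some p}) : cnt π A p ≤ cnt ρ B p := by
  rw [cnt_eq_ncard, cnt_eq_ncard]
  exact Set.ncard_le_ncard_of_injOn f (fun i hi => h i hi.1 hi.2) hf (Set.toFinite _)

/-- Tokens of `A` can be mapped injectively to tokens of `B` in the same places if no place has
more of the former than of the latter. -/
lemma exists_injOn_of_cnt_le {π ρ : Placement Q k} {A B : Set (Fin k)}
    (hA : ∀ i ∈ A, π i ≠ none) (h : ∀ p, cnt π A p ≤ cnt ρ B p) :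
    ∃ f : Fin k → Fin k, Set.InjOn f A ∧ ∀ i ∈ A, f i ∈ B ∧ ρ (f i) = π i := by
  rcases isEmpty_or_nonempty (Fin k) with hk | hk
  · exact ⟨id, Function.injective_id.injOn, fun i => isEmptyElim i⟩
  have hf : ∀ p, ∃ f : Fin k → Fin k,
      (∀ i, i ∈ A ∧ π i = some p → f i ∈ B ∧ ρ (f i) = some p) ∧
      Set.InjOn f {i | i ∈ A ∧ π i = some p} := by
    intro p
    have hp := h p
    rw [cnt_eq_ncard, cnt_eq_ncard] at hp
    obtain ⟨f, hf, hinj⟩ := (Set.toFinite {i | i ∈ A ∧ π i = some p}).exists_injOn_of_encard_le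
      (t := {i | i ∈ B ∧ ρ i = some p}) (by
        rwa [← (Set.toFinite _).cast_ncard_eq, ← (Set.toFinite _).cast_ncard_eq, Nat.cast_le])
    exact ⟨f, fun i hi => hf hi, hinj⟩
  choose f hf hinj using hf
  refine ⟨fun i => (π i).elim i fun p => f p i, fun i hi j hj hij => ?_, fun i hi => ?_⟩
  · obtain ⟨p, hp⟩ := Option.ne_none_iff_exists'.1 (hA i hi)
    obtain ⟨q, hq⟩ := Option.ne_none_iff_exists'.1 (hA j hj)
    simp only [hp, hq, Option.elim] at hij
    have h1 := (hf p i ⟨hi, hp⟩).2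
    rw [hij, (hf q j ⟨hj, hq⟩).2] at h1
    obtain rfl := Option.some_injective _ h1
    exact hinj q ⟨hi, hp⟩ ⟨hj, hq⟩ hij
  · obtain ⟨p, hp⟩ := Option.ne_none_iff_exists'.1 (hA i hi)
    simp only [hp, Option.elim]
    exact hf p i ⟨hi, hp⟩

end PlacementsAndDelays

/-! ### The zones explored by the algorithm -/

lemma AgeSim.mem_invZone {π : Placement P k} {v w : Valuation k}
    (h : ∀ i, N.AgeSim (π i) (v i) (w i)) (hv : v ∈ N.invZone π) : w ∈ N.invZone π :=
  fun i => (h i).mem_invariant (hv i)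

section DelayExtrapolate

variable {π : Placement P k} {D : DBM k}

lemma canonicalOf_delayZone_spec (hne : D.zone.Nonempty) (hinv : D.zone ⊆ N.invZone π) :
    (DBM.canonicalOf (delayZone D.zone ∩ N.invZone π)).Canonical ∧
    (DBM.canonicalOf (delayZone D.zone ∩ N.invZone π)).zone = delayZone D.zone ∩ N.invZone π := by
  refine canonicalOf_spec ((isZone_delayZone D.isZone hne).inter (isZone_invZone N π)) ?_
  obtain ⟨v, hv⟩ := hne
  exact ⟨v, ⟨v, hv, 0, (delay_zero v).symm⟩, hinv hv⟩

lemma zone_delayExtrapolate (hne : D.zone.Nonempty) (hinv : D.zone ⊆ N.invZone π) :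
    (N.delayExtrapolate π D).zone = ((DBM.canonicalOf
      (delayZone D.zone ∩ N.invZone π)).extrapolate fun i => N.mc (π i)).zone := by
  refine canonicalOf_extrapolate_spec _ _ ?_
  rw [(canonicalOf_delayZone_spec hne hinv).2]
  obtain ⟨v, hv⟩ := hne
  exact ⟨v, ⟨v, hv, 0, (delay_zero v).symm⟩, hinv hv⟩

lemma delay_mem_delayExtrapolate (hinv : D.zone ⊆ N.invZone π) {u : Valuation k}
    (hu : u ∈ D.zone) {d : ℝ≥0} (hd : delay u d ∈ N.invZone π) :
    delay u d ∈ (N.delayExtrapolate π D).zone := by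
  rw [zone_delayExtrapolate ⟨u, hu⟩ hinv]
  refine DBM.zone_subset_extrapolate _ _ ?_
  rw [(canonicalOf_delayZone_spec ⟨u, hu⟩ hinv).2]
  exact ⟨⟨u, hu, d, rfl⟩, hd⟩

lemma exists_delay_of_mem_delayExtrapolate (hne : D.zone.Nonempty)
    (hinv : D.zone ⊆ N.invZone π) {v : Valuation k} (hv : v ∈ (N.delayExtrapolate π D).zone) :
    ∃ u ∈ D.zone, ∃ d, delay u d ∈ N.invZone π ∧
      ∀ i, N.AgeSim (π i) (v i) (delay u d i) := by
  rw [zone_delayExtrapolate hne hinv] at hv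
  obtain ⟨hcan, hzone⟩ := canonicalOf_delayZone_spec hne hinv
  obtain ⟨w, hw, hvw⟩ := hcan.exists_mem_zone hv
  rw [hzone] at hw
  obtain ⟨⟨u, hu, d, rfl⟩, hd⟩ := hw
  exact ⟨u, hu, d, hd, fun i => .of_eq_or_mc_lt (hvw i)⟩

variable (N π) in
/-- The matrices that the algorithm can produce for the placement `π`. -/
def stateDBMs : Set (DBM k) :=
  (fun E : DBM k => DBM.canonicalOf E.zone) ''
    {E | ∃ D : DBM k, D.Canonical ∧ E = D.extrapolate fun i => N.mc (π i)}

variable (N π) in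
lemma finite_stateDBMs : (N.stateDBMs π).Finite := (DBM.finite_extrapolate _).image _

lemma delayExtrapolate_mem_stateDBMs (hne : D.zone.Nonempty) (hinv : D.zone ⊆ N.invZone π) :
    N.delayExtrapolate π D ∈ N.stateDBMs π :=
  ⟨_, ⟨_, (canonicalOf_delayZone_spec hne hinv).1, rfl⟩, rfl⟩

end DelayExtrapolate

/-! ### Realizable markings -/

/-- The marking `(π, v)` is reachable up to indistinguishable ages, with any number of additional
unused tokens. -/
def Realizable (pr : N.Pairing) (π₀ π : Placement P k) (v : Valuation k) : Prop :=
  ∀ n : ℕ, ∃ w : Valuation (k + n),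
    Reaches pr (initMarking (pad π₀ n)) (pad π n, w) ∧
    ∀ i, N.AgeSim (π i) (v i) (w (Fin.castAdd n i))

variable {π₀ : Placement P k}

lemma realizable_init : Realizable pr π₀ π₀ fun _ => 0 := fun _ =>
  ⟨fun _ => 0, .refl, fun _ => .refl _ _⟩

lemma Realizable.congr {π : Placement P k} {v v' : Valuation k} (h : Realizable pr π₀ π v')
    (hv : ∀ i, N.AgeSim (π i) (v i) (v' i)) : Realizable pr π₀ π v := by
  intro n
  obtain ⟨w, hw, hs⟩ := h n
  exact ⟨w, hw, fun i => (hv i).trans (hs i)⟩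

lemma Realizable.delay {π : Placement P k} {v : Valuation k} (h : Realizable pr π₀ π v) {d : ℝ≥0}
    (hd : delay v d ∈ N.invZone π) : Realizable pr π₀ π (delay v d) := by
  intro n
  obtain ⟨w, hw, hs⟩ := h n
  refine ⟨TimedArc.delay w d, hw.tail ⟨_, Step.delay _ d fun i => ?_⟩, fun i => (hs i).add d⟩
  induction i using Fin.addCases with
  | left i =>
    simp only [pad_castAdd]
    exact ((hs i).add d).mem_invariant (hd i)
  | right i =>
    simp only [pad_natAdd]
    exact Interval.mem_all _

lemma IsMove.pad {π π' : Placement P k} {IN : Finset (Fin k)} {t : T} (h : IsMove pr π IN t π')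
    (n : ℕ) : IsMove pr (pad π n) (IN.map (Fin.castAddEmb n)) t (pad π' n) := by
  obtain ⟨⟨e, he⟩, hout⟩ := h
  let f : {i // i ∈ IN} ≃ {j // j ∈ IN.map (Fin.castAddEmb n)} :=
    Equiv.ofBijective (fun i => ⟨Fin.castAdd n i.1, Finset.mem_map_of_mem _ i.2⟩)
      ⟨fun i j hij => Subtype.ext (Fin.castAdd_injective k n (congrArg Subtype.val hij)), by
        rintro ⟨j, hj⟩
        obtain ⟨i, hi, rfl⟩ := Finset.mem_map.1 hj
        exact ⟨⟨i, hi⟩, rfl⟩⟩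
  refine ⟨⟨f.symm.trans e, fun j => ?_⟩, fun j hj => ?_⟩
  · obtain ⟨i, rfl⟩ := f.surjective j
    rw [Equiv.trans_apply, Equiv.symm_apply_apply]
    have : (f i).1 = Fin.castAdd n i.1 := rfl
    rw [this, pad_castAdd, pad_castAdd]
    exact he i
  · induction j using Fin.addCases with
    | left i =>
      rw [pad_castAdd, pad_castAdd]
      exact hout i fun hi => hj (Finset.mem_map_of_mem _ hi)
    | right i => rw [pad_natAdd, pad_natAdd]

lemma not_isInhibitor_none (t : T) : ¬ N.IsInhibitor none t := by
  rintro ⟨_, h, -⟩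
  cases h

lemma Realizable.fire {π π' : Placement P k} {v : Valuation k} {IN : Finset (Fin k)} {t : T}
    (h : Realizable pr π₀ π v) (hE : Enabled pr (π, v) IN t π') :
    Realizable pr π₀ π' (reset v (N.resetSet π IN t)) := by
  intro n
  obtain ⟨w, hw, hs⟩ := h n
  have hE' : Enabled pr (pad π n, w) (IN.map (Fin.castAddEmb n)) t (pad π' n) := by
    refine hE.transfer ((map_pad π IN n).trans hE.1) (hE.2.1.pad n) (fun j hj => ?_) ?_
    · induction j using Fin.addCases with
      | left i =>
        rw [pad_castAdd]
        exact hE.2.2.2.2 i fun hi => hj (Finset.mem_map_of_mem _ hi)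
      | right i =>
        rw [pad_natAdd]
        exact not_isInhibitor_none t
    · intro i hi j hj p hip hjp
      obtain ⟨j, hjIN, rfl⟩ := Finset.mem_map.1 hj
      have hjp' : π j = some p := (pad_castAdd π n j).symm.trans hjp
      obtain rfl := eq_of_map_eq_augPreset hE.1 hi hjIN hip hjp'
      exact hip ▸ hs i
  refine ⟨_, hw.tail ⟨_, Step.fire _ t _ _ hE'⟩, fun i => ?_⟩
  by_cases hi : i ∈ IN
  · exact .reset hi (Finset.mem_map_of_mem _ hi) (pad_castAdd π n i) (fun _ => hs i) _
  · have hi' : Fin.castAdd n i ∉ IN.map (Fin.castAddEmb n) := by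
      intro h
      obtain ⟨j, hj, hji⟩ := Finset.mem_map.1 h
      exact hi (Fin.castAdd_injective k n hji ▸ hj)
    rw [reset_of_notMem hi, reset_of_notMem hi', hE.2.1.2 i hi]
    exact hs i

/-- In a bounded net the unused tokens suffice to fire a transition whose proper input places are
served by the tokens `J` of a realizable marking: otherwise it could be fired with additional
tokens, which would lead to too many used tokens. -/
lemma Realizable.width_sub_le (hb : Bounded pr π₀) {m : ℕ} {π : Placement P k} {v : Valuation k}
    (h : Realizable pr π₀ π v) {ρ ρ' : Placement P m} {u : Valuation m} {IN : Finset (Fin m)}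
    {t : T} (hE : Enabled pr (ρ, u) IN t ρ') {J : Finset (Fin k)}
    (hJ : J.val.map π = (N.preset t).val.map some)
    (hinh : ∀ j, j ∉ J → ¬ N.IsInhibitor (π j) t)
    (hsim : ∀ i ∈ IN, ∀ j ∈ J, ∀ p, ρ i = some p → π j = some p →
      N.AgeSim (some p) (u i) (v j)) :
    N.width t - (N.preset t).card ≤ (Finset.univ.filter fun i => π i = none).card := by
  set b := N.width t - (N.preset t).card with hbdef
  obtain ⟨w, hw, hs⟩ := h b
  let IN' : Finset (Fin (k + b)) :=
    J.map (Fin.castAddEmb b) ∪ Finset.univ.map (Fin.natAddEmb k)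
  have hmap : IN'.val.map (pad π b) = N.augPreset t := by
    refine map_union_eq_augPreset ((map_pad π J b).trans hJ) (fun i hi => ?_) (by simp [hbdef])
    obtain ⟨i, -, rfl⟩ := Finset.mem_map.1 hi
    exact pad_natAdd π b i
  obtain ⟨π', hmove⟩ := exists_isMove (pr := pr) hmap
  have hE' : Enabled pr (pad π b, w) IN' t π' := by
    refine hE.transfer hmap hmove (fun j hj => ?_) ?_
    · induction j using Fin.addCases with
      | left i =>
        rw [pad_castAdd]
        exact hinh i fun hi => hj (Finset.mem_union_left _ (Finset.mem_map_of_mem _ hi))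
      | right i =>
        rw [pad_natAdd]
        exact not_isInhibitor_none t
    · intro i hi j hj p hip hjp
      induction j using Fin.addCases with
      | left j =>
        rw [pad_castAdd] at hjp
        have hjJ : j ∈ J := by
          rcases Finset.mem_union.1 hj with hj | hj
          · obtain ⟨a, ha, haj⟩ := Finset.mem_map.1 hj
            exact Fin.castAdd_injective k b haj ▸ ha
          · obtain ⟨a, -, haj⟩ := Finset.mem_map.1 hj
            have := congrArg Fin.val haj
            simp at this
            omega
        exact (hsim i hi j hjJ p hip hjp).trans (hjp ▸ hs j)
      | right j =>
        rw [pad_natAdd] at hjp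
        cases hjp
  have hk := hb b _ (hw.tail ⟨_, Step.fire _ t _ _ hE'⟩)
  -- the used tokens after the firing: those that were used and not moved, and the moved ones
  -- that have arrived in the output places
  have hout : (N.postset t).card ≤ (IN'.filter fun i => π' i ≠ none).card := by
    have hsub : (N.postset t).image some ⊆ (IN'.filter fun i => π' i ≠ none).image π' := by
      intro x hx
      obtain ⟨p, hp, rfl⟩ := Finset.mem_image.1 hx
      obtain ⟨⟨e, he⟩, -⟩ := hmove
      have hp' : some p ∈ (pr.pairs t).val.map Prod.snd := by
        rw [pr.map_snd]
        exact mem_augPostset_some.2 hp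
      obtain ⟨y, hy, hyp⟩ := Multiset.mem_map.1 hp'
      have h1 := (he (e.symm ⟨y, hy⟩)).2
      rw [Equiv.apply_symm_apply] at h1
      refine Finset.mem_image.2 ⟨(e.symm ⟨y, hy⟩).1, Finset.mem_filter.2 ⟨(e.symm ⟨y, hy⟩).2, ?_⟩,
        h1.trans hyp⟩
      rw [h1, hyp]
      simp
    calc (N.postset t).card = ((N.postset t).image some).card :=
          (Finset.card_image_of_injective _ (Option.some_injective P)).symm
      _ ≤ _ := (Finset.card_le_card hsub).trans Finset.card_image_le
  let U := Finset.univ.filter fun i => π i ≠ none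
  have hJU : J ⊆ U := by
    intro j hj
    have := Multiset.mem_map_of_mem π hj
    rw [hJ] at this
    obtain ⟨p, -, hp⟩ := Multiset.mem_map.1 this
    simp [U, ← hp]
  have hJcard : J.card = (N.preset t).card := by
    simpa using congrArg Multiset.card hJ
  have hUcard : (Finset.univ.filter fun i => π i = none).card + U.card = k := by
    rw [Finset.card_filter_add_card_filter_not, Finset.card_univ, Fintype.card_fin]
  have hsub : ((U \ J).map (Fin.castAddEmb b)) ∪ (IN'.filter fun i => π' i ≠ none) ⊆
      Finset.univ.filter fun i => π' i ≠ none := by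
    intro i hi
    rcases Finset.mem_union.1 hi with hi | hi
    · obtain ⟨a, ha, rfl⟩ := Finset.mem_map.1 hi
      obtain ⟨haU, haJ⟩ := Finset.mem_sdiff.1 ha
      have hnot : Fin.castAdd b a ∉ IN' := by
        intro h
        rcases Finset.mem_union.1 h with h | h
        · obtain ⟨c, hc, hca⟩ := Finset.mem_map.1 h
          exact haJ (Fin.castAdd_injective k b hca ▸ hc)
        · obtain ⟨c, -, hca⟩ := Finset.mem_map.1 h
          have := congrArg Fin.val hca
          simp at this
          omega
      refine Finset.mem_filter.2 ⟨Finset.mem_univ _, ?_⟩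
      change π' (Fin.castAdd b a) ≠ none
      rw [hmove.2 _ hnot, pad_castAdd]
      exact (Finset.mem_filter.1 haU).2
    · exact Finset.mem_filter.2 ⟨Finset.mem_univ _, (Finset.mem_filter.1 hi).2⟩
  have hdisj : Disjoint ((U \ J).map (Fin.castAddEmb b)) (IN'.filter fun i => π' i ≠ none) := by
    rw [Finset.disjoint_left]
    intro i hi hi'
    obtain ⟨a, ha, rfl⟩ := Finset.mem_map.1 hi
    have h := (Finset.mem_filter.1 hi').1
    rcases Finset.mem_union.1 h with h | h
    · obtain ⟨c, hc, hca⟩ := Finset.mem_map.1 h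
      exact (Finset.mem_sdiff.1 ha).2 ((Fin.castAddEmb b).injective hca ▸ hc)
    · obtain ⟨c, -, hca⟩ := Finset.mem_map.1 h
      have := congrArg Fin.val hca
      simp at this
      omega
  have hcard := Finset.card_le_card hsub
  rw [Finset.card_union_of_disjoint hdisj, Finset.card_map, Finset.card_sdiff_of_subset hJU] at hcard
  have hJle := Finset.card_le_card hJU
  have hw' : N.width t = max (N.preset t).card (N.postset t).card := rfl
  simp only at hk
  rcases max_cases (N.preset t).card (N.postset t).card with hmx | hmx <;> omega

/-! ### The inclusion ordering is a preorder -/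

lemma Included.refl (Pinc : Set P) (M : SymMarking P k) : N.Included Pinc M M :=
  ⟨⟨Equiv.refl _, fun _ => rfl, fun v hv => ⟨v, hv, fun _ => Or.inl rfl⟩⟩, fun _ => le_rfl⟩

lemma Included.trans {Pinc : Set P} {M M' M'' : SymMarking P k} (h : N.Included Pinc M M')
    (h' : N.Included Pinc M' M'') : N.Included Pinc M M'' := by
  obtain ⟨⟨e, he, hv⟩, hc⟩ := h
  obtain ⟨⟨e', he', hv'⟩, hc'⟩ := h'
  refine ⟨⟨e.trans e', fun i => (he i).trans (he' _), fun v hvM => ?_⟩,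
    fun p => (hc p).trans (hc' p)⟩
  obtain ⟨w, hw, hvw⟩ := hv v hvM
  obtain ⟨u, hu, hwu⟩ := hv' w hw
  refine ⟨u, hu, fun i => ?_⟩
  rcases hvw i with h1 | h1
  · rw [h1, he i]
    exact hwu (e i)
  · rcases hwu (e i) with h2 | h2
    · exact Or.inr ⟨h1.1, by
        change (N.mc (M''.1 (e' (e i)).1) : ℝ≥0) < u (e' (e i)).1
        rw [← h2, ← he' (e i)]
        exact h1.2⟩
    · exact Or.inr ⟨h1.1, h2.2⟩

/-! ### Covering of concrete by symbolic markings -/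

/-- The condition on the infimum of the ages of an inclusion token says that all of them exceed the
maximum constant of its place. -/
lemma mem_incTokens_iff {Pinc : Set P} {M : SymMarking P k} (hne : M.2.Nonempty) {i : Fin k} :
    i ∈ N.incTokens Pinc M ↔ ∃ p ∈ Pinc, M.1 i = some p ∧ N.inv p = Interval.all ∧
      (∀ t, ¬ N.IsInhibitor (some p) t) ∧
      (N.Untimed p ∨ ∀ v ∈ M.2, (N.mc (some p) : ℝ≥0) < v i) := by
  have key : ∀ p, ((sInf {x | ∃ v ∈ M.2, x = v i} ∈ {x | ∃ v ∈ M.2, x = v i} →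
        (N.mc (some p) : ℝ≥0) < sInf {x | ∃ v ∈ M.2, x = v i}) ∧
      (sInf {x | ∃ v ∈ M.2, x = v i} ∉ {x | ∃ v ∈ M.2, x = v i} →
        (N.mc (some p) : ℝ≥0) ≤ sInf {x | ∃ v ∈ M.2, x = v i})) ↔
      ∀ v ∈ M.2, (N.mc (some p) : ℝ≥0) < v i := by
    intro p
    constructor
    · rintro ⟨h1, h2⟩ v hv
      have hle : sInf {x | ∃ v ∈ M.2, x = v i} ≤ v i := csInf_le' ⟨v, hv, rfl⟩
      by_cases hmem : sInf {x | ∃ v ∈ M.2, x = v i} ∈ {x | ∃ v ∈ M.2, x = v i}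
      · exact (h1 hmem).trans_le hle
      · refine (h2 hmem).trans_lt (hle.lt_of_ne fun h => hmem ?_)
        exact ⟨v, hv, h⟩
    · intro h
      refine ⟨?_, fun _ => ?_⟩
      · rintro ⟨v, hv, he⟩
        rw [he]
        exact h v hv
      · obtain ⟨v, hv⟩ := hne
        refine le_csInf ⟨_, v, hv, rfl⟩ ?_
        rintro _ ⟨v, hv, rfl⟩
        exact (h v hv).le
  constructor
  · rintro ⟨⟨p, hp, hinv, hinh, h⟩, q, hq, hpq⟩
    obtain rfl : p = q := Option.some_injective _ (hp.symm.trans hpq)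
    exact ⟨p, hq, hp, hinv, hinh, h.imp_right (key p).1⟩
  · rintro ⟨p, hpinc, hp, hinv, hinh, h⟩
    exact ⟨⟨p, hp, hinv, hinh, h.imp_right (key p).2⟩, p, hpinc, hp⟩

variable (N) in
/-- The symbolic marking `S` covers the concrete marking `M`: for some valuation of `S`, the used
tokens of `M` correspond to used tokens of `S` in the same places and of indistinguishable ages,
and all further used tokens of `S` are inclusion tokens. -/
def Covers (Pinc : Set P) (S : SymMarking P k) (M : Marking P k) : Prop :=
  ∃ v ∈ S.2, ∃ g : Fin k → Fin k, Set.InjOn g {i | M.1 i ≠ none} ∧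
    (∀ i, M.1 i ≠ none → S.1 (g i) = M.1 i ∧ N.AgeSim (M.1 i) (M.2 i) (v (g i))) ∧
    ∀ j, S.1 j ≠ none → (∀ i, M.1 i ≠ none → g i ≠ j) → j ∈ N.incTokens Pinc S

/-- Covering is monotone with respect to the inclusion ordering. -/
lemma Covers.mono {Pinc : Set P} {S S' : SymMarking P k} {M : Marking P k}
    (h : N.Covers Pinc S M) (hinc : N.Included Pinc S S') : N.Covers Pinc S' M := by
  obtain ⟨v, hv, g, hg, hgM, hrest⟩ := h
  obtain ⟨⟨e, he, hee⟩, hcnt⟩ := hinc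
  obtain ⟨v', hv', hvv'⟩ := hee v hv
  -- the tokens of `M` that correspond to inclusion tokens of `S`
  let I : Set (Fin k) := {i | M.1 i ≠ none ∧ g i ∈ N.incTokens Pinc S}
  have hIcnt : ∀ p, cnt M.1 I p ≤ cnt S'.1 (N.incTokens Pinc S') p := by
    intro p
    refine le_trans ?_ (hcnt p)
    exact cnt_le_cnt_of_injOn g (fun i hi hip => ⟨hi.2, (hgM i hi.1).1.trans hip⟩)
      fun i hi j hj hij => hg hi.1.1 hj.1.1 hij
  obtain ⟨f, hf, hfI⟩ := exists_injOn_of_cnt_le (fun i hi => hi.1) hIcnt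
  have hnotbot : ∀ j, j ∈ N.eqTokens Pinc S ↔ S.1 j ≠ none ∧ j ∉ N.incTokens Pinc S := by
    intro j
    simp [eqTokens, botTokens]
  have hnotbot' : ∀ j, j ∈ N.eqTokens Pinc S' ↔ S'.1 j ≠ none ∧ j ∉ N.incTokens Pinc S' := by
    intro j
    simp [eqTokens, botTokens]
  have heq : ∀ i, M.1 i ≠ none → i ∉ I → g i ∈ N.eqTokens Pinc S := fun i hi hiI =>
    (hnotbot _).2 ⟨by rw [(hgM i hi).1]; exact hi, fun h => hiI ⟨hi, h⟩⟩
  let g' : Fin k → Fin k := fun i =>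
    if i ∈ I then f i else if h : g i ∈ N.eqTokens Pinc S then (e ⟨g i, h⟩).1 else i
  have g'_inc : ∀ i, i ∈ I → g' i = f i := fun i hi => if_pos hi
  have g'_eq : ∀ i (hi : M.1 i ≠ none) (hiI : i ∉ I), g' i = (e ⟨g i, heq i hi hiI⟩).1 :=
    fun i hi hiI => (if_neg hiI).trans (dif_pos (heq i hi hiI))
  refine ⟨v', hv', g', fun i hi j hj hij => ?_, fun i hi => ?_, fun j hj hjr => ?_⟩
  · by_cases hiI : i ∈ I <;> by_cases hjI : j ∈ I
    · rw [g'_inc i hiI, g'_inc j hjI] at hij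
      exact hf hiI hjI hij
    · rw [g'_inc i hiI, g'_eq j hj hjI] at hij
      exact absurd (hfI i hiI).1 (hij ▸ ((hnotbot' _).1 (e ⟨g j, heq j hj hjI⟩).2).2)
    · rw [g'_eq i hi hiI, g'_inc j hjI] at hij
      exact absurd (hfI j hjI).1 (hij ▸ ((hnotbot' _).1 (e ⟨g i, heq i hi hiI⟩).2).2)
    · rw [g'_eq i hi hiI, g'_eq j hj hjI] at hij
      exact hg hi hj (congrArg Subtype.val (e.injective (Subtype.ext hij)))
  · by_cases hiI : i ∈ I
    · rw [g'_inc i hiI]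
      obtain ⟨hfi, hfp⟩ := hfI i hiI
      refine ⟨hfp, ?_⟩
      obtain ⟨p, -, hp, -, -, h1⟩ := (mem_incTokens_iff ⟨v, hv⟩).1 hiI.2
      obtain ⟨q, -, hq, -, -, h2⟩ := (mem_incTokens_iff ⟨v', hv'⟩).1 hfi
      have hMp : M.1 i = some p := (hgM i hi).1.symm.trans hp
      obtain rfl : p = q := Option.some_injective _ (hMp.symm.trans (hfp.symm.trans hq))
      intro r hr
      obtain rfl : p = r := Option.some_injective _ (hMp.symm.trans hr)
      by_cases hu : N.Untimed p
      · exact Or.inr (Or.inr hu)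
      · have h3 := (hgM i hi).2
        rw [hMp] at h3
        exact Or.inr (Or.inl ⟨h3.symm.mc_lt hu (h1.resolve_left hu v hv),
          h2.resolve_left hu v' hv'⟩)
    · rw [g'_eq i hi hiI]
      have h1 := he ⟨g i, heq i hi hiI⟩
      have h2 := hvv' ⟨g i, heq i hi hiI⟩
      have h3 := hgM i hi
      refine ⟨h1.symm.trans h3.1, h3.2.trans ?_⟩
      rw [← h3.1]
      rw [← h1] at h2
      exact .of_eq_or_mc_lt h2
  · by_contra hjinc
    obtain ⟨⟨j', hj'⟩, hee'⟩ := e.surjective ⟨j, (hnotbot' j).2 ⟨hj, hjinc⟩⟩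
    have h1 := (hnotbot j').1 hj'
    by_cases hr : ∃ i, M.1 i ≠ none ∧ g i = j'
    · obtain ⟨i, hi, rfl⟩ := hr
      have hiI : i ∉ I := fun h => h1.2 h.2
      refine hjr i hi ?_
      rw [g'_eq i hi hiI, hee']
    · push Not at hr
      exact h1.2 (hrest j' h1.1 hr)

/-- Predicates without monotonicity-breaking atoms on inclusion places are preserved by covering. -/
lemma Covers.sat {Pinc : Set P} {S : SymMarking P k} {M : Marking P k}
    (h : N.Covers Pinc S M) {ψ : Predicate P} (hψ : ∀ p ∈ Pinc, ¬ ψ.Breaking p)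
    (hM : ψ.Sat M.1) : ψ.Sat S.1 := by
  obtain ⟨v, hv, g, hg, hgM, hrest⟩ := h
  have hle : ∀ p, cnt M.1 Set.univ p ≤ cnt S.1 Set.univ p := by
    intro p
    exact cnt_le_cnt_of_injOn g
      (fun i _ hip => ⟨trivial, (hgM i (by simp [hip])).1.trans hip⟩)
      fun i hi j hj hij => hg (by simp [hi.2]) (by simp [hj.2]) hij
  have heq : ∀ p ∉ Pinc, cnt M.1 Set.univ p = cnt S.1 Set.univ p := by
    intro p hp
    refine le_antisymm (hle p) ?_
    rw [cnt_eq_ncard, cnt_eq_ncard]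
    refine (Set.ncard_le_ncard (t := g '' {i | i ∈ Set.univ ∧ M.1 i = some p}) ?_
      (Set.toFinite _)).trans (Set.ncard_image_le (Set.toFinite _))
    rintro j ⟨-, hjp⟩
    by_contra hcon
    obtain ⟨-, q, hq, hjq⟩ := hrest j (by simp [hjp]) fun i hi hij => hcon
      ⟨i, ⟨trivial, by rw [← (hgM i hi).1, hij, hjp]⟩, hij⟩
    exact hp (Option.some_injective _ (hjq.symm.trans hjp) ▸ hq)
  clear hrest hgM
  induction ψ with
  | atom p r n =>
    by_cases hb : (Predicate.atom p r n).Breaking p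
    · have hp : p ∉ Pinc := fun hp => hψ p hp hb
      simp only [Predicate.Sat] at hM ⊢
      rwa [← heq p hp]
    · simp only [Predicate.Sat] at hM ⊢
      have := hle p
      cases r <;> simp [Predicate.Breaking, Cmp.Holds] at hb hM ⊢ <;> omega
  | and φ χ ih1 ih2 =>
    exact ⟨ih1 (fun p hp h => hψ p hp (Or.inl h)) hM.1,
      ih2 (fun p hp h => hψ p hp (Or.inr h)) hM.2⟩
  | or φ χ ih1 ih2 =>
    exact hM.imp (ih1 fun p hp h => hψ p hp (Or.inl h)) (ih2 fun p hp h => hψ p hp (Or.inr h))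

/-! ### The explored symbolic markings -/

/-- The properties shared by all symbolic markings that the algorithm explores: they belong to a
finite set, their zones are non-empty, satisfy the invariants, are closed under delays up to
indistinguishable ages, and consist of realizable valuations. -/
structure IsState (pr : N.Pairing) (π₀ : Placement P k) (S : DBMMarking P k) : Prop where
  mem : S.2 ∈ N.stateDBMs S.1
  nonempty : S.2.zone.Nonempty
  inv : S.2.zone ⊆ N.invZone S.1
  delay : ∀ v ∈ S.2.zone, ∀ d, delay v d ∈ N.invZone S.1 →
    ∃ w ∈ S.2.zone, ∀ i, N.AgeSim (S.1 i) (delay v d i) (w i)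
  realizable : ∀ v ∈ S.2.zone, Realizable pr π₀ S.1 v

lemma isState_delayExtrapolate {π : Placement P k} {D : DBM k} (hne : D.zone.Nonempty)
    (hinv : D.zone ⊆ N.invZone π) (hreal : ∀ v ∈ D.zone, Realizable pr π₀ π v) :
    IsState pr π₀ (π, N.delayExtrapolate π D) where
  mem := delayExtrapolate_mem_stateDBMs hne hinv
  nonempty := by
    obtain ⟨v, hv⟩ := hne
    exact ⟨_, delay_mem_delayExtrapolate hinv hv (d := 0) (by rw [delay_zero]; exact hinv hv)⟩
  inv v hv := by
    obtain ⟨u, -, d, hd, hs⟩ := exists_delay_of_mem_delayExtrapolate hne hinv hv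
    exact AgeSim.mem_invZone (fun i => (hs i).symm) hd
  delay v hv e he := by
    obtain ⟨u, hu, d, -, hs⟩ := exists_delay_of_mem_delayExtrapolate hne hinv hv
    have hs' : ∀ i, N.AgeSim (π i) (TimedArc.delay v e i) (TimedArc.delay u (d + e) i) := by
      intro i
      rw [← delay_delay]
      exact (hs i).add e
    exact ⟨_, delay_mem_delayExtrapolate hinv hu (AgeSim.mem_invZone hs' he), hs'⟩
  realizable v hv := by
    obtain ⟨u, hu, d, hd, hs⟩ := exists_delay_of_mem_delayExtrapolate hne hinv hv
    exact ((hreal u hu).delay hd).congr hs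

lemma zone_subset_zone_delayExtrapolate {π : Placement P k} {D : DBM k}
    (hinv : D.zone ⊆ N.invZone π) : D.zone ⊆ (N.delayExtrapolate π D).zone := by
  intro v hv
  have := delay_mem_delayExtrapolate hinv hv (d := 0) (by rw [delay_zero]; exact hinv hv)
  rwa [delay_zero] at this

lemma canonicalOf_zero_zone : (DBM.canonicalOf {(fun _ => 0 : Valuation k)}).zone = {fun _ => 0} :=
  (canonicalOf_spec isZone_zero (Set.singleton_nonempty _)).2

lemma zero_mem_invZone (π : Placement P k) : (fun _ => 0 : Valuation k) ∈ N.invZone π := by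
  intro i
  rcases h : π i with _ | p
  · exact Interval.mem_all _
  · exact N.inv_zero p

variable (pr π₀) in
lemma isState_initState : IsState pr π₀ (N.initState π₀) := by
  refine isState_delayExtrapolate ?_ ?_ ?_ <;> rw [canonicalOf_zero_zone]
  · exact Set.singleton_nonempty _
  · rintro _ rfl
    exact zero_mem_invZone π₀
  · rintro _ rfl
    exact realizable_init

lemma covers_initState (Pinc : Set P) :
    N.Covers Pinc (N.initState π₀).sym (initMarking π₀) := by
  refine ⟨fun _ => 0, ?_, id, Function.injective_id.injOn, fun i _ => ⟨rfl, .refl _ _⟩,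
    fun j hj h => absurd rfl (h j hj)⟩
  refine zone_subset_zone_delayExtrapolate ?_ ?_ <;> rw [canonicalOf_zero_zone]
  · rintro _ rfl
    exact zero_mem_invZone π₀
  · rfl

variable (pr π₀) in
lemma finite_isState : {S : DBMMarking P k | IsState pr π₀ S}.Finite := by
  refine (Set.finite_iUnion fun π : Placement P k =>
    (Set.finite_singleton π).prod (finite_stateDBMs N π)).subset ?_
  intro S hS
  exact Set.mem_iUnion.2 ⟨S.1, rfl, hS.mem⟩

lemma canonicalOf_fireZone_zone {M : DBMMarking P k} {IN : Finset (Fin k)} {t : T}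
    {π' : Placement P k} (hne : (N.fireZone M IN t π').Nonempty) :
    (DBM.canonicalOf (N.fireZone M IN t π')).zone = N.fireZone M IN t π' :=
  (canonicalOf_spec (isZone_fireZone N M IN t π' hne) hne).2

/-- Soundness of the successor generation. -/
lemma IsState.succ {mv : MoveFun pr k} {S S' : DBMMarking P k} (hS : IsState pr π₀ S)
    (h : S' ∈ succ mv S) : IsState pr π₀ S' := by
  obtain ⟨t, IN, hmap, hinh, hne, rfl⟩ := h
  refine isState_delayExtrapolate ?_ ?_ ?_ <;> rw [canonicalOf_fireZone_zone hne]
  · exact hne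
  · exact Set.inter_subset_right
  · rintro _ ⟨⟨v, ⟨hv, hguard⟩, rfl⟩, hinv⟩
    refine (hS.realizable v hv).fire ⟨hmap, mv.isMove S.1 IN t hmap, hguard, fun i hi ht => ?_, hinh⟩
    have h := hinv i
    have hi : i ∉ N.resetSet S.1 IN t := fun h => h.2 ht
    simpa only [reset, hi, if_false] using h

/-! ### Simulation of concrete by symbolic markings -/

/-- Surplus tokens do not block delays: inclusion tokens are in places with invariant `[0,∞)`. -/
lemma Covers.delay {Pinc : Set P} {S : DBMMarking P k} (hS : IsState pr π₀ S)
    {M : Marking P k} (h : N.Covers Pinc S.sym M) {d : ℝ≥0}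
    (hd : ∀ i, M.2 i + d ∈ (N.invariant (M.1 i)).toSet) :
    N.Covers Pinc S.sym (M.1, delay M.2 d) := by
  obtain ⟨v, hv, g, hg, hgM, hrest⟩ := h
  have hinv : TimedArc.delay v d ∈ N.invZone S.1 := by
    intro j
    by_cases hj : S.1 j = none
    · rw [hj]
      exact Interval.mem_all _
    by_cases hr : ∃ i, M.1 i ≠ none ∧ g i = j
    · obtain ⟨i, hi, rfl⟩ := hr
      have h1 := ((hgM i hi).2.add d).mem_invariant (hd i)
      rwa [← (hgM i hi).1] at h1
    · push Not at hr
      obtain ⟨p, -, hp, hall, -⟩ := (mem_incTokens_iff ⟨v, hv⟩).1 (hrest j hj hr)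
      have hp' : S.1 j = some p := hp
      simp only [hp', invariant, hall]
      exact Interval.mem_all _
  obtain ⟨w, hw, hvw⟩ := hS.delay v hv d hinv
  refine ⟨w, hw, g, hg, fun i hi => ⟨(hgM i hi).1, ?_⟩, hrest⟩
  have h1 := hvw (g i)
  have h2 : S.1 (g i) = M.1 i := (hgM i hi).1
  rw [h2] at h1
  exact ((hgM i hi).2.add d).trans h1

/-- The used tokens among those that enable a transition are the ones in its proper input places. -/
lemma map_filter_eq_preset {m : ℕ} {ρ : Placement P m} {IN : Finset (Fin m)} {t : T}
    (h : IN.val.map ρ = N.augPreset t) :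
    (IN.filter fun i => ρ i ≠ none).val.map ρ = (N.preset t).val.map some := by
  have h1 : ((IN.val.map ρ).filter fun x => x ≠ none) = (N.preset t).val.map some := by
    rw [h, augPreset, Multiset.filter_add, Multiset.filter_eq_self.2, Multiset.filter_eq_nil.2,
      add_zero]
    · intro x hx
      simp [Multiset.eq_of_mem_replicate hx]
    · intro x hx
      obtain ⟨p, -, rfl⟩ := Multiset.mem_map.1 hx
      simp
  rw [Multiset.filter_map] at h1
  exact h1

/-- A symbolic marking that covers a concrete one can simulate the firing of transitions. -/
lemma Covers.fire (hb : Bounded pr π₀) (mv : MoveFun pr k) {Pinc : Set P} {S : DBMMarking P k}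
    (hS : IsState pr π₀ S) {ρ ρ' : Placement P k} {u : Valuation k}
    (h : N.Covers Pinc S.sym (ρ, u)) {INc : Finset (Fin k)} {t : T}
    (hE : Enabled pr (ρ, u) INc t ρ') :
    ∃ S' ∈ succ mv S, N.Covers Pinc S'.sym (ρ', reset u (N.resetSet ρ INc t)) := by
  obtain ⟨π, D⟩ := S
  obtain ⟨v, hv, g, hg, hgM, hrest⟩ := h
  change v ∈ D.zone at hv
  change Set.InjOn g {i | ρ i ≠ none} at hg
  change ∀ i, ρ i ≠ none → π (g i) = ρ i ∧ N.AgeSim (ρ i) (u i) (v (g i)) at hgM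
  change ∀ j, π j ≠ none → (∀ i, ρ i ≠ none → g i ≠ j) → j ∈ N.incTokens Pinc (π, D.zone) at hrest
  -- the tokens of the symbolic marking that correspond to the used tokens among `INc`
  let Jc := INc.filter fun i => ρ i ≠ none
  have hJc : ∀ {i}, i ∈ Jc ↔ i ∈ INc ∧ ρ i ≠ none := by simp [Jc]
  let J := Jc.image g
  have hJmap : J.val.map π = (N.preset t).val.map some := by
    have hinj : Set.InjOn g Jc := fun i hi j hj hij => hg (hJc.1 hi).2 (hJc.1 hj).2 hij
    rw [← map_filter_eq_preset hE.1, Finset.image_val_of_injOn hinj, Multiset.map_map]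
    exact Multiset.map_congr rfl fun i hi => (hgM i (hJc.1 hi).2).1
  have hJinh : ∀ j, j ∉ J → ¬ N.IsInhibitor (π j) t := by
    intro j hj hinh
    have hjb : π j ≠ none := by
      intro h
      rw [h] at hinh
      exact not_isInhibitor_none t hinh
    by_cases hr : ∃ i, ρ i ≠ none ∧ g i = j
    · obtain ⟨i, hi, rfl⟩ := hr
      refine hE.2.2.2.2 i (fun hiIN => hj (Finset.mem_image_of_mem g (hJc.2 ⟨hiIN, hi⟩))) ?_
      rwa [(hgM i hi).1] at hinh
    · push Not at hr
      obtain ⟨p, -, hp, -, hno, -⟩ := (mem_incTokens_iff ⟨v, hv⟩).1 (hrest j hjb hr)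
      have hp' : π j = some p := hp
      rw [hp'] at hinh
      exact hno t hinh
  have hJsim : ∀ i ∈ INc, ∀ j ∈ J, ∀ p, ρ i = some p → π j = some p →
      j = g i ∧ N.AgeSim (some p) (u i) (v j) := by
    intro i hi j hj p hip hjp
    obtain ⟨a, ha, rfl⟩ := Finset.mem_image.1 hj
    obtain ⟨haIN, ha0⟩ := hJc.1 ha
    rw [(hgM a ha0).1] at hjp
    obtain rfl := eq_of_map_eq_augPreset hE.1 hi haIN hip hjp
    exact ⟨rfl, hip ▸ (hgM i ha0).2⟩
  -- by boundedness, enough unused tokens are left to complete the preset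
  obtain ⟨B, hBsub, hBcard⟩ := Finset.exists_subset_card_eq
    ((hS.realizable v hv).width_sub_le hb hE hJmap hJinh
      fun i hi j hj p hip hjp => (hJsim i hi j hj p hip hjp).2)
  have hB : ∀ i ∈ B, π i = none := fun i hi => (Finset.mem_filter.1 (hBsub hi)).2
  let IN := J ∪ B
  have hmap : IN.val.map π = N.augPreset t := map_union_eq_augPreset hJmap hB hBcard
  have hINJ : ∀ j ∈ IN, ∀ p, π j = some p → j ∈ J := by
    intro j hj p hp
    rcases Finset.mem_union.1 hj with hj | hj
    · exact hj
    · rw [hB j hj] at hp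
      cases hp
  have hinh : ∀ j, j ∉ IN → ¬ N.IsInhibitor (π j) t := fun j hj =>
    hJinh j fun h => hj (Finset.mem_union_left _ h)
  let π' := mv.move π IN t
  have hmove : IsMove pr π IN t π' := mv.isMove π IN t hmap
  have hE' : Enabled pr (π, v) IN t π' := hE.transfer hmap hmove hinh
    fun i hi j hj p hip hjp => (hJsim i hi j (hINJ j hj p hjp) p hip hjp).2
  let v' := reset v (N.resetSet π IN t)
  have hv'inv : v' ∈ N.invZone π' := by
    intro i
    by_cases hi : i ∈ IN
    · by_cases ht : N.IsTransport (π i) t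
      · have hi' : i ∉ N.resetSet π IN t := fun h => h.2 ht
        simp only [v', reset, hi', if_false]
        exact hE'.2.2.2.1 i hi ht
      · have hi' : i ∈ N.resetSet π IN t := ⟨hi, ht⟩
        simp only [v', reset, hi', if_true]
        exact zero_mem_invZone π' i
    · simp only [v', reset_of_notMem hi]
      rw [hmove.2 i hi]
      exact hS.inv hv i
  have hv'fire : v' ∈ N.fireZone (π, D) IN t π' := ⟨⟨v, ⟨hv, hE'.2.2.1⟩, rfl⟩, hv'inv⟩
  have hne : (N.fireZone (π, D) IN t π').Nonempty := ⟨v', hv'fire⟩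
  have hzone := canonicalOf_fireZone_zone hne
  have hsubinv : (DBM.canonicalOf (N.fireZone (π, D) IN t π')).zone ⊆ N.invZone π' := by
    rw [hzone]
    exact Set.inter_subset_right
  let S' : DBMMarking P k :=
    (π', N.delayExtrapolate π' (DBM.canonicalOf (N.fireZone (π, D) IN t π')))
  have hv'S : v' ∈ S'.2.zone := zone_subset_zone_delayExtrapolate hsubinv (by rwa [hzone])
  refine ⟨S', ⟨t, IN, hmap, hinh, hne, rfl⟩, ?_⟩
  obtain ⟨σ, hσ⟩ := hE.2.1.exists_equiv hmove
  -- moved tokens correspond along the routes, all others as before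
  let g' : Fin k → Fin k := fun i => if hi : i ∈ INc then (σ ⟨i, hi⟩).1 else g i
  have g'_in : ∀ i (hi : i ∈ INc), g' i = (σ ⟨i, hi⟩).1 := fun i hi => dif_pos hi
  have g'_out : ∀ i, i ∉ INc → g' i = g i := fun i hi => dif_neg hi
  have hρ' : ∀ i, i ∉ INc → ρ' i = ρ i := hE.2.1.2
  have hgout : ∀ i, i ∉ INc → ρ i ≠ none → g i ∉ IN := by
    intro i hi hi0 hIN
    obtain ⟨p, hp⟩ := Option.ne_none_iff_exists'.1 hi0
    obtain ⟨a, ha, hag⟩ := Finset.mem_image.1 (hINJ (g i) hIN p ((hgM i hi0).1.trans hp))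
    exact hi (hg (hJc.1 ha).2 hi0 hag ▸ (hJc.1 ha).1)
  refine ⟨v', hv'S, g', fun i hi j hj hij => ?_, fun i hi => ?_, fun j hj hjr => ?_⟩
  · change ρ' i ≠ none at hi
    change ρ' j ≠ none at hj
    by_cases hi' : i ∈ INc <;> by_cases hj' : j ∈ INc
    · rw [g'_in i hi', g'_in j hj'] at hij
      exact congrArg Subtype.val (σ.injective (Subtype.ext hij))
    · rw [g'_in i hi', g'_out j hj'] at hij
      exact absurd (hij ▸ (σ ⟨i, hi'⟩).2) (hgout j hj' (hρ' j hj' ▸ hj))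
    · rw [g'_out i hi', g'_in j hj'] at hij
      exact absurd (hij ▸ (σ ⟨j, hj'⟩).2) (hgout i hi' (hρ' i hi' ▸ hi))
    · rw [g'_out i hi', g'_out j hj'] at hij
      rw [hρ' i hi'] at hi
      rw [hρ' j hj'] at hj
      exact hg hi hj hij
  · change ρ' i ≠ none at hi
    change π' (g' i) = ρ' i ∧ N.AgeSim (ρ' i) (reset u (N.resetSet ρ INc t) i) (v' (g' i))
    by_cases hi' : i ∈ INc
    · rw [g'_in i hi']
      refine ⟨(hσ ⟨i, hi'⟩).2, .reset hi' (σ ⟨i, hi'⟩).2 (hσ ⟨i, hi'⟩).1 (fun h0 => ?_) _⟩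
      intro p hp
      have hp' := (hσ ⟨i, hi'⟩).1.trans hp
      exact (hJsim i hi' _ (hINJ _ (σ ⟨i, hi'⟩).2 p hp') p hp hp').2 p rfl
    · have hi0 : ρ i ≠ none := hρ' i hi' ▸ hi
      have hgi := hgout i hi' hi0
      rw [g'_out i hi', hρ' i hi', reset_of_notMem hi', hmove.2 _ hgi]
      simp only [v', reset_of_notMem hgi]
      exact hgM i hi0
  · change π' j ≠ none at hj
    have hjIN : j ∉ IN := by
      intro hjIN
      obtain ⟨i, hi⟩ := σ.surjective ⟨j, hjIN⟩
      have h1 := (hσ i).2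
      rw [hi] at h1
      refine hjr i.1 ?_ ?_
      · change ρ' i.1 ≠ none
        rw [← h1]
        exact hj
      · rw [g'_in i.1 i.2]
        exact congrArg Subtype.val hi
    have hπ' : π' j = π j := hmove.2 j hjIN
    rw [hπ'] at hj
    have hjinc := hrest j hj fun i hi hij => by
      subst hij
      have hi' : i ∉ INc := fun hi' =>
        hjIN (Finset.mem_union_left _ (Finset.mem_image_of_mem g (hJc.2 ⟨hi', hi⟩)))
      refine hjr i ?_ (g'_out i hi')
      change ρ' i ≠ none
      rwa [hρ' i hi']
    obtain ⟨p, hpinc, hp, hall, hno, hage⟩ := (mem_incTokens_iff ⟨v, hv⟩).1 hjinc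
    have hp' : π j = some p := hp
    refine (mem_incTokens_iff ⟨v', hv'S⟩).2 ⟨p, hpinc, hπ'.trans hp', hall, hno, ?_⟩
    by_cases hu : N.Untimed p
    · exact Or.inl hu
    refine Or.inr fun w hw => ?_
    -- ages of unmoved inclusion tokens stay above the maximum constant
    obtain ⟨x, hx, d, -, hs⟩ := exists_delay_of_mem_delayExtrapolate (by rwa [hzone]) hsubinv hw
    rw [hzone] at hx
    obtain ⟨⟨y, ⟨hy, -⟩, rfl⟩, -⟩ := hx
    have h1 := hage.resolve_left hu y hy
    have h2 := hs j
    rw [hπ', hp'] at h2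
    refine h2.symm.mc_lt hu (h1.trans_le ?_)
    change y j ≤ reset y (N.resetSet π IN t) j + d
    rw [reset_of_notMem hjIN]
    exact le_self_add

/-! ### The algorithm -/

lemma union_singleton_union_sdiff {α : Type*} {passed waiting : Set α} {M : α}
    (h : M ∈ waiting) : passed ∪ {M} ∪ waiting \ {M} = passed ∪ waiting := by
  rw [Set.union_assoc, Set.union_sdiff_self, Set.union_eq_self_of_subset_left
    (Set.singleton_subset_iff.2 h)]

variable (N) in
/-- Some element of `X` is above `S` in the inclusion ordering. -/
def Below (Pinc : Set P) (X : Set (DBMMarking P k)) (S : DBMMarking P k) : Prop :=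
  ∃ S' ∈ X, N.Included Pinc S.sym S'.sym

lemma Below.of_mem {Pinc : Set P} {X : Set (DBMMarking P k)} {S : DBMMarking P k} (h : S ∈ X) :
    N.Below Pinc X S := ⟨S, h, .refl _ _⟩

/-- Adding a symbolic marking to one of the lists and removing the elements below it preserves what
is below the lists. -/
lemma Below.add {Pinc : Set P} {passed waiting : Set (DBMMarking P k)} {S : DBMMarking P k}
    (h : N.Below Pinc (passed ∪ waiting) S) (M : DBMMarking P k) :
    N.Below Pinc ((passed \ {M' | N.Included Pinc M'.sym M.sym}) ∪
      ((waiting \ {M' | N.Included Pinc M'.sym M.sym}) ∪ {M})) S := by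
  obtain ⟨S', hS', hinc⟩ := h
  by_cases hM : N.Included Pinc S'.sym M.sym
  · exact ⟨M, Or.inr (Or.inr rfl), hinc.trans hM⟩
  · rcases hS' with h | h
    · exact ⟨S', Or.inl ⟨h, hM⟩, hinc⟩
    · exact ⟨S', Or.inr (Or.inl ⟨h, hM⟩), hinc⟩

/-- The loop invariant of the algorithm; `todo` holds the successors still to be treated. -/
structure LoopInv (mv : MoveFun pr k) (π₀ : Placement P k) (Pinc : Set P) (ψ : Predicate P)
    (todo passed waiting : Set (DBMMarking P k)) : Prop where
  isState_todo : ∀ S ∈ todo, IsState pr π₀ S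
  isState : ∀ S ∈ passed ∪ waiting, IsState pr π₀ S
  not_sat : ∀ S ∈ passed ∪ waiting, ¬ ψ.Sat S.1
  init : N.Below Pinc (passed ∪ waiting) (N.initState π₀)
  succ : ∀ S ∈ passed, ∀ S' ∈ succ mv S, S' ∈ todo ∨ N.Below Pinc (passed ∪ waiting) S'

variable {mv : MoveFun pr k} {Pinc : Set P} {ψ : Predicate P}
  {todo passed waiting : Set (DBMMarking P k)}

lemma LoopInv.take (h : LoopInv mv π₀ Pinc ψ ∅ passed waiting) {M : DBMMarking P k}
    (hM : M ∈ waiting) :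
    LoopInv mv π₀ Pinc ψ (TAPN.succ mv M) (passed ∪ {M}) (waiting \ {M}) := by
  have hunion := union_singleton_union_sdiff (passed := passed) hM
  refine ⟨fun S hS => (h.isState M (Or.inr hM)).succ hS, ?_, ?_, ?_, ?_⟩
  · rw [hunion]; exact h.isState
  · rw [hunion]; exact h.not_sat
  · rw [hunion]; exact h.init
  · rw [hunion]
    rintro S (hS | rfl) S' hS'
    · exact Or.inr ((h.succ S hS S' hS').resolve_left id)
    · exact Or.inl hS'

lemma LoopInv.discard (h : LoopInv mv π₀ Pinc ψ todo passed waiting) {M : DBMMarking P k}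
    (hM : N.Below Pinc (passed ∪ waiting) M) :
    LoopInv mv π₀ Pinc ψ (todo \ {M}) passed waiting where
  isState_todo S hS := h.isState_todo S hS.1
  isState := h.isState
  not_sat := h.not_sat
  init := h.init
  succ S hS S' hS' := by
    rcases h.succ S hS S' hS' with h | h
    · by_cases he : S' = M
      · exact Or.inr (he ▸ hM)
      · exact Or.inl ⟨h, he⟩
    · exact Or.inr h

lemma LoopInv.add (h : LoopInv mv π₀ Pinc ψ todo passed waiting) {M : DBMMarking P k}
    (hM : M ∈ todo) (hsat : ¬ ψ.Sat M.1) :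
    LoopInv mv π₀ Pinc ψ (todo \ {M}) (passed \ {M' | N.Included Pinc M'.sym M.sym})
      ((waiting \ {M' | N.Included Pinc M'.sym M.sym}) ∪ {M}) where
  isState_todo S hS := h.isState_todo S hS.1
  isState := by
    rintro S (hS | hS | rfl)
    · exact h.isState S (Or.inl hS.1)
    · exact h.isState S (Or.inr hS.1)
    · exact h.isState_todo S hM
  not_sat := by
    rintro S (hS | hS | rfl)
    · exact h.not_sat S (Or.inl hS.1)
    · exact h.not_sat S (Or.inr hS.1)
    · exact hsat
  init := h.init.add M
  succ S hS S' hS' := by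
    rcases h.succ S hS.1 S' hS' with h | h
    · by_cases he : S' = M
      · exact Or.inr (.of_mem (Or.inr (Or.inr he)))
      · exact Or.inl ⟨h, he⟩
    · exact Or.inr (h.add M)

/-- When no symbolic marking is left to be explored, the explored ones cover all reachable
markings, so that the property cannot be satisfied. -/
lemma LoopInv.not_satEF (hb : Bounded pr π₀) (hPinc : ∀ p ∈ Pinc, ¬ ψ.Breaking p)
    (h : LoopInv mv π₀ Pinc ψ ∅ passed ∅) : ¬ SatEF pr (initMarking π₀) ψ := by
  have hI := h.init
  have hS := h.succ
  have hstate := h.isState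
  have hsat := h.not_sat
  rw [Set.union_empty] at hI hS hstate hsat
  rintro ⟨M', hreach, hM'⟩
  have key : ∀ M, Reaches pr (initMarking π₀) M → ∃ S ∈ passed, N.Covers Pinc S.sym M := by
    intro M hM
    induction hM with
    | refl =>
      obtain ⟨S, hS, hinc⟩ := hI
      exact ⟨S, hS, (covers_initState Pinc).mono hinc⟩
    | tail _ hstep ih =>
      obtain ⟨S, hSp, hcov⟩ := ih
      obtain ⟨a, hstep⟩ := hstep
      cases hstep with
      | fire t IN π' hE =>
        obtain ⟨S', hS', hcov'⟩ := hcov.fire hb mv (hstate S hSp) hE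
        obtain ⟨S'', hS'', hinc⟩ := (hS S hSp S' hS').resolve_left id
        exact ⟨S'', hS'', hcov'.mono hinc⟩
      | delay d hd => exact ⟨S, hSp, hcov.delay (hstate S hSp) hd⟩
  obtain ⟨S, hSp, hcov⟩ := key M' hreach
  exact hsat S hSp (hcov.sat hPinc hM')

/-- The termination measure: the number of explorable symbolic markings not below the lists, which
decreases whenever one is added; the length of the waiting list; and the number of remaining
steps of the inner loop. -/
def measure (pr : N.Pairing) (π₀ : Placement P k) (Pinc : Set P)
    (todo : Option (Set (DBMMarking P k))) (passed waiting : Set (DBMMarking P k)) :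
    ℕ ×ₗ ℕ ×ₗ ℕ :=
  toLex ({S | IsState pr π₀ S ∧ ¬ N.Below Pinc (passed ∪ waiting) S}.ncard,
    toLex (waiting.ncard, todo.elim 0 fun X => X.ncard + 1))

/-- Under the loop invariant, every run of the algorithm returns YES. -/
lemma LoopInv.returnsFrom (hb : Bounded pr π₀) (hPinc : ∀ p ∈ Pinc, ¬ ψ.Breaking p)
    (hEF : SatEF pr (initMarking π₀) ψ) (mv : MoveFun pr k) (μ : ℕ ×ₗ ℕ ×ₗ ℕ) :
    (∀ passed waiting, measure pr π₀ Pinc none passed waiting = μ →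
      LoopInv mv π₀ Pinc ψ ∅ passed waiting →
      ReturnsFrom (AlgStep mv π₀ Pinc ψ) (.done true) (.loop passed waiting)) ∧
    ∀ todo passed waiting, measure pr π₀ Pinc (some todo) passed waiting = μ →
      LoopInv mv π₀ Pinc ψ todo passed waiting →
      ReturnsFrom (AlgStep mv π₀ Pinc ψ) (.done true) (.inner todo passed waiting) := by
  induction μ using WellFoundedLT.induction with
  | ind μ ih =>
  constructor
  · rintro passed waiting rfl hI
    have hfin : waiting.Finite := (finite_isState pr π₀).subset fun S hS => hI.isState S (Or.inr hS)
    have hne : waiting ≠ ∅ := by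
      rintro rfl
      exact hI.not_satEF hb hPinc hEF
    obtain ⟨M₀, hM₀⟩ := Set.nonempty_iff_ne_empty.2 hne
    refine .next _ ⟨_, .take passed waiting M₀ hM₀⟩ fun c hc => ?_
    cases hc with
    | exit => exact absurd rfl hne
    | take _ _ M hM =>
      refine (ih _ ?_).2 _ _ _ rfl (hI.take hM)
      have hunion := union_singleton_union_sdiff (passed := passed) hM
      simp only [measure, hunion]
      exact Prod.Lex.right _ (Prod.Lex.left _ _ (Set.ncard_sdiff_singleton_lt_of_mem hM hfin))
  · rintro todo passed waiting rfl hI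
    have hfin : todo.Finite := (finite_isState pr π₀).subset fun S hS => hI.isState_todo S hS
    have hless : ∀ M ∈ todo, measure pr π₀ Pinc (some (todo \ {M})) passed waiting <
        measure pr π₀ Pinc (some todo) passed waiting := fun M hM =>
      Prod.Lex.right _ (Prod.Lex.right _
        (Nat.succ_lt_succ (Set.ncard_sdiff_singleton_lt_of_mem hM hfin)))
    refine .next _ ?_ fun c hc => ?_
    · rcases todo.eq_empty_or_nonempty with rfl | ⟨M, hM⟩
      · exact ⟨_, .back passed waiting⟩
      · by_cases hinc : ∃ M' ∈ passed ∪ waiting, N.Included Pinc M.sym M'.sym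
        · exact ⟨_, .discard todo passed waiting M hM hinc⟩
        · by_cases hsat : ψ.Sat M.1
          · exact ⟨_, .found todo passed waiting M hM hinc hsat⟩
          · exact ⟨_, .add todo passed waiting M hM hinc hsat⟩
    · cases hc with
      | back =>
        refine (ih _ ?_).1 _ _ rfl hI
        exact Prod.Lex.right _ (Prod.Lex.right _ (Nat.succ_pos _))
      | discard _ _ _ M hM hinc =>
        exact (ih _ (hless M hM)).2 _ _ _ rfl (hI.discard hinc)
      | found => exact .final
      | add _ _ _ M hM hinc hsat =>
        refine (ih _ ?_).2 _ _ _ rfl (hI.add hM hsat)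
        refine Prod.Lex.left _ _ (Set.ncard_lt_ncard ?_
          ((finite_isState pr π₀).subset fun S hS => hS.1))
        refine ⟨fun S hS => ⟨hS.1, fun h => hS.2 (h.add M)⟩, fun hsub => ?_⟩
        exact (hsub ⟨hI.isState_todo M hM, hinc⟩).2 (.of_mem (Or.inr (Or.inr rfl)))

end TAPN

end TimedArc

end

theorem mainTheorem4 {P T : Type*} [Fintype P] [Fintype T] (N : TimedArc.TAPN P T)
    (pr : N.Pairing) (k : ℕ) (π₀ : TimedArc.Placement P k)
    (hbounded : TimedArc.TAPN.Bounded pr π₀)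
    (mv : TimedArc.TAPN.MoveFun pr k)
    (Pinc : Set P) (ψ : TimedArc.Predicate P)
    (hPinc : ∀ p ∈ Pinc, ¬ ψ.Breaking p)
    (hEF : TimedArc.TAPN.SatEF pr (TimedArc.TAPN.initMarking π₀) ψ) :
    TimedArc.TAPN.ReturnsYes mv π₀ Pinc ψ := by
  open TimedArc TimedArc.TAPN in
  by_cases hsat : ψ.Sat (N.initState π₀).1
  · refine .next _ ⟨_, .startYes hsat⟩ fun c hc => ?_
    cases hc with
    | startYes => exact .final
    | startLoop h => exact absurd hsat h
  · refine .next _ ⟨_, .startLoop hsat⟩ fun c hc => ?_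
    cases hc with
    | startYes h => exact absurd h hsat
    | startLoop =>
      refine (LoopInv.returnsFrom hbounded hPinc hEF mv _).1 _ _ rfl ?_
      refine ⟨by simp, ?_, ?_, .of_mem (Or.inr rfl), by simp⟩
      · rintro S (h | rfl)
        · exact h.elim
        · exact isState_initState pr π₀
      · rintro S (h | rfl)
        · exact h.elim
        · exact hsat
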